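/- Let $k$ be a field, $S=k[x_1,\dots,x_n]$, let $\prec$ be a monomial order on $S$ refining the total degree with $x_1\succ x_2\succ\dots\succ x_n$ (for example degree-lex), and let $\mathfrak a\subset S$ be an ideal that has a quadratic Gröbner basis with respect to $\prec$, i.e. a Gröbner basis consisting of homogeneous polynomials of degree $2$. Put $A=S/\mathfrak a$, let $\mathfrak m=\langle x_1,\dots,x_n\rangle\subset A$, and identify $k=A/\mathfrak m$. Let $\mathcal G$ be the set of standard monomials of degree $\ge 1$. Let $\mathbf{NB}_\bullet$ be the normalized bar resolution of $k$ over $A$: it is $A$-free on the cells $[w_1|\dots|w_l]$ with $w_i\in\mathcal G$, in homological degree $l\ge 0$, with $$\partial[w_1|\dots|w_l]=w_1[w_2|\dots|w_l]+\sum_{j=1}^{l-1}(-1)^j\sum_{v\in\mathcal G}a_{j,v}[w_1|\dots|w_{j-1}|v|w_{j+2}|\dots|w_l]\quad(l\ge1),$$ where $a_{j,v}\in k$ is the coefficient of $v$ in the normal form of $w_jw_{j+1}$. Write $[c:c']$ for the coefficient of the cell $c'$ in $\partial c$, and consider the directed graph on the cells with an edge $c\to c'$ whenever $[c:c']\ne0$.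 Define sets $\mathcal M_1,\mathcal M_2,\dots$ of edges as follows. $\mathcal M_1$ consists of the edges $[x_{m(w)}|w'|w_2|\dots]\to[w|w_2|\dots]$ with $w=x_{m(w)}w'$, where $m(w)=\min\{i: x_i\mid w\}$. For $j\ge2$ let $\mathcal B_{j-1}$ be the set of cells on no edge of $\mathcal M_1\cup\dots\cup\mathcal M_{j-1}$; then $\mathcal M_j$ consists of the edges $[p|u_1|u_2|q]\to[p|u_1u_2|q]$ between cells of $\mathcal B_{j-1}$, where $p$ is a sequence of length $j-1$ and $q$ is any sequence, such that $u_1$ is the $\prec$-largest divisor $u$ of $w=u_1u_2$ with $[p|u|w/u|q]\in\mathcal B_{j-1}$ and $[p|v|w/v|q]\notin\mathcal B_{j-1}$ for every proper divisor $v$ of $u$. Let $\mathcal M=\bigcup_j\mathcal M_j$. A cell is critical if it lies on no edge of $\mathcal M$. Let $G_{\mathcal M}$ be the graph obtained by reversing the edges in $\mathcal M$, a reversed edge $c'\to c$ having weight $-1/[c:c']$ and every other edge $c\to c'$ having weight $[c:c']$. Then $\mathcal M$ is an acyclic matching (each cell lies on at most one edge of $\mathcal M$, the coefficients $[c:c']$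 along $\mathcal M$ are units, and $G_{\mathcal M}$ has no directed cycle), and from each cell there start only finitely many directed paths in $G_{\mathcal M}$. Let $F_\bullet$ be the Morse complex: $F_i$ is the free $A$-module on the critical cells of homological degree $i$, and $\partial c=\sum_{c'}\Gamma(c,c')\,c'$, where $c'$ runs over the critical cells of degree $i-1$ and $\Gamma(c,c')$ is the sum, over all directed paths from $c$ to $c'$ in $G_{\mathcal M}$, of the products of the weights of their edges. Then $F_\bullet$, with the augmentation $F_0\to k$, $[\,]\mapsto1$, is a minimal free resolution of $k$ over $A$: the sequence $\cdots\to F_2\to F_1\to F_0\to k\to0$ is exact, and $\partial F_{i+1}\subseteq\mathfrak m F_i$ for all $i\ge 0$. -/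

import Mathlib

open scoped MonomialOrder

noncomputable section

/-! ## Algebraic discrete Morse theory

A based complex of free `R`-modules is given by the set `C` of all its basis elements ("cells") and
by `D : C → C →₀ R`, the differential of a cell; so `D c c'` is the coefficient `[c : c']`. -/

namespace AlgMorse

variable {C R : Type*} [CommRing R]

/-- The edges of the graph `G_M`: the edges `c ⟶ c'` of `G` (those with `[c : c'] ≠ 0`) that are not
in the matching, and the reversed edges of the matching.
`M c c'` means that the edge `c ⟶ c'` belongs to the matching. -/
def Step (D : C → C →₀ R) (M : C → C → Prop) (c c' : C) : Prop :=
  (D c c' ≠ 0 ∧ ¬ M c c') ∨ M c' c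

/-- `M` is an acyclic matching on the graph of the based complex. -/
structure IsAcyclicMatching (D : C → C →₀ R) (M : C → C → Prop) : Prop where
  edge : ∀ c c', M c c' → D c c' ≠ 0
  matching : ∀ v a b a' b', M a b → M a' b' → (v = a ∨ v = b) → (v = a' ∨ v = b') → a = a' ∧ b = b'
  invertible : ∀ c c', M c c' → IsUnit (D c c')
  acyclic : ∀ c, ¬ Relation.TransGen (Step D M) c c

/-- A cell is critical if it lies on no edge of the matching. -/
def IsCritical (M : C → C → Prop) (c : C) : Prop :=
  ∀ c', ¬ M c c' ∧ ¬ M c' c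

/-- The list of cells `p` is a (directed) path in the graph `G_M`; paths consist of at least one cell
as soon as a starting point is prescribed, and the one-cell path is allowed. -/
def IsPath (D : C → C →₀ R) (M : C → C → Prop) (p : List C) : Prop :=
  p.IsChain (Step D M)

open Classical in
/-- The weight of a step: `-1/[c' : c]` along a reversed edge of the matching, `[c : c']` else. -/
def stepWeight (D : C → C →₀ R) (M : C → C → Prop) (c c' : C) : R :=
  if M c' c then - Ring.inverse (D c' c) else D c c'

/-- The weight of a path: the product of the weights of its steps. -/
def pathWeight (D : C → C →₀ R) (M : C → C → Prop) : List C → R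
  | c :: c' :: p => stepWeight D M c c' * pathWeight D M (c' :: p)
  | _ => 1

/-- `Γ(c, c')`: the sum of the weights of all paths from `c` to `c'`. -/
def Gam (D : C → C →₀ R) (M : C → C → Prop) (c c' : C) : R :=
  ∑ᶠ p ∈ {p : List C | IsPath D M p ∧ p.head? = some c ∧ p.getLast? = some c'}, pathWeight D M p

/-- The critical cells of homological degree `i`. -/
abbrev CriticalCell (M : C → C → Prop) (deg : C → ℕ) (i : ℕ) : Type _ :=
  {c : C // IsCritical M c ∧ deg c = i}

/-- The module in degree `i` of the Morse complex: free on the critical cells of degree `i`. -/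
abbrev MorseModule (R : Type*) [CommRing R] (M : C → C → Prop) (deg : C → ℕ) (i : ℕ) : Type _ :=
  CriticalCell M deg i →₀ R

/-- The Morse differential `c ↦ ∑ Γ(c, c') c'`, the sum being over the critical cells `c'` of degree
one less. -/
def morseD (D : C → C →₀ R) (M : C → C → Prop) (deg : C → ℕ) (i : ℕ) :
    MorseModule R M deg (i + 1) →ₗ[R] MorseModule R M deg i :=
  Finsupp.linearCombination R fun c : CriticalCell M deg (i + 1) =>
    ∑ᶠ c' : CriticalCell M deg i, Finsupp.single c' (Gam D M c.1 c'.1)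

end AlgMorse

/-! ## Gröbner bases and normal forms -/

namespace CommAnick

variable {k : Type*} [Field k] {n : ℕ}

/-- The monomial order refines the total degree. -/
def IsDegreeOrder (m : MonomialOrder (Fin n)) : Prop :=
  ∀ u v : Fin n →₀ ℕ, u.degree < v.degree → u ≺[m] v

/-- `B` is a Gröbner basis of `a`: it is contained in `a` and its leading terms generate the initial
ideal of `a`. -/
def IsGroebnerBasis (m : MonomialOrder (Fin n)) (B : Set (MvPolynomial (Fin n) k))
    (a : Ideal (MvPolynomial (Fin n) k)) : Prop :=
  B ⊆ a ∧ Ideal.span (m.leadingTerm '' B) =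
    Ideal.span (m.leadingTerm '' (a : Set (MvPolynomial (Fin n) k)))

/-- The monomial with exponent `v` is standard: it is not the leading monomial of an element
of `a`. -/
def IsStandard (m : MonomialOrder (Fin n)) (a : Ideal (MvPolynomial (Fin n) k))
    (v : Fin n →₀ ℕ) : Prop :=
  ∀ f ∈ a, f ≠ 0 → m.degree f ≠ v

theorem exists_normalForm (m : MonomialOrder (Fin n)) (a : Ideal (MvPolynomial (Fin n) k))
    (f : MvPolynomial (Fin n) k) :
    ∃ r : MvPolynomial (Fin n) k, f - r ∈ a ∧ ∀ v ∈ r.support, IsStandard m a v := by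
  obtain ⟨g, r, hf, -, hr⟩ := MonomialOrder.div_set (m := m)
    (B := {b : MvPolynomial (Fin n) k | b ∈ a ∧ b ≠ 0})
    (fun b hb => (MonomialOrder.leadingCoeff_ne_zero_iff.2 hb.2).isUnit) f
  refine ⟨r, ?_, fun v hv h ha h0 hd => hr v hv h ⟨ha, h0⟩ hd.le⟩
  rw [hf, add_sub_cancel_right, Finsupp.linearCombination_apply]
  exact a.sum_mem fun b _ => a.mul_mem_left _ b.2.1

/-- The normal form of `f`: the linear combination of standard monomials congruent to `f`
modulo `a`. -/
def normalForm (m : MonomialOrder (Fin n)) (a : Ideal (MvPolynomial (Fin n) k))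
    (f : MvPolynomial (Fin n) k) : MvPolynomial (Fin n) k :=
  (exists_normalForm m a f).choose

/-- The normal form is determined by its two defining properties. -/
theorem eq_normalForm (m : MonomialOrder (Fin n)) (a : Ideal (MvPolynomial (Fin n) k))
    (f r : MvPolynomial (Fin n) k) (h1 : f - r ∈ a) (h2 : ∀ v ∈ r.support, IsStandard m a v) :
    r = normalForm m a f := by
  obtain ⟨g1, g2⟩ := (exists_normalForm m a f).choose_spec
  change f - normalForm m a f ∈ a at g1
  change ∀ v ∈ (normalForm m a f).support, IsStandard m a v at g2
  by_contra hne
  have hne : r - normalForm m a f ≠ 0 := sub_ne_zero.2 hne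
  have hmem : r - normalForm m a f ∈ a := by
    have := a.sub_mem g1 h1
    simpa using this
  have hs := (MonomialOrder.degree_mem_support_iff (m := m) _).2 hne
  classical
  rcases Finset.mem_union.1 (MvPolynomial.support_sub (Fin n) _ _ hs) with h | h
  · exact h2 _ h _ hmem hne rfl
  · exact g2 _ h _ hmem hne rfl

/-! ## The normalized bar resolution -/

/-- The set `𝒢` of standard monomials of degree at least one (written as exponents). -/
abbrev StdMon (m : MonomialOrder (Fin n)) (a : Ideal (MvPolynomial (Fin n) k)) : Type :=
  {v : Fin n →₀ ℕ // v ≠ 0 ∧ IsStandard m a v}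

/-- The cells `[w₁|…|w_l]` of the normalized bar resolution; the homological degree is the length. -/
abbrev Cell (m : MonomialOrder (Fin n)) (a : Ideal (MvPolynomial (Fin n) k)) : Type :=
  List (StdMon m a)

/-- The quotient algebra `A`. -/
abbrev QuotAlg (a : Ideal (MvPolynomial (Fin n) k)) : Type _ := MvPolynomial (Fin n) k ⧸ a

/-- The ideal of `A` generated by the residue classes of the variables. -/
def maxIdeal (a : Ideal (MvPolynomial (Fin n) k)) : Ideal (QuotAlg a) :=
  Ideal.span (Set.range fun i : Fin n => Ideal.Quotient.mk a (MvPolynomial.X i))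

variable (m : MonomialOrder (Fin n)) (a : Ideal (MvPolynomial (Fin n) k))

open Classical in
/-- The inner part of the bar differential of `[w₁|…|w_l]`,
`∑_{1 ≤ j < l} (-1)^j ∑_{v ∈ 𝒢} a_{j,v} [w₁|…|w_{j-1}|v|w_{j+2}|…|w_l]`, where `a_{j,v}` is the
coefficient of `v` in the normal form of `w_j w_{j+1}`. -/
def mergeD : Cell m a → Cell m a →₀ QuotAlg a
  | w :: w' :: c =>
      - (∑ v ∈ (normalForm m a (MvPolynomial.monomial (w.1 + w'.1) 1)).support.subtype
            (fun v => v ≠ 0 ∧ IsStandard m a v),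
          Finsupp.single (v :: c) (algebraMap k (QuotAlg a)
            ((normalForm m a (MvPolynomial.monomial (w.1 + w'.1) 1)).coeff v.1)))
      - (mergeD (w' :: c)).mapDomain (fun c' => w :: c')
  | _ => 0

/-- The differential of the normalized bar resolution on cells:
`∂[w₁|…|w_l] = w₁[w₂|…|w_l] + (inner part)`. -/
def barD : Cell m a → Cell m a →₀ QuotAlg a
  | [] => 0
  | w :: c =>
      Finsupp.single c (Ideal.Quotient.mk a (MvPolynomial.monomial w.1 1)) + mergeD m a (w :: c)

/-! ## The matching -/

/-- The first matching: `[x_{m(w)}|w'|…] ⟶ [w|…]` for `w = x_{m(w)} w'`, where `m(w)` is the least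
index of a variable dividing `w`. -/
def firstMatching (c c' : Cell m a) : Prop :=
  ∃ (x w' w : StdMon m a) (q : Cell m a) (i : Fin n),
    c = x :: w' :: q ∧ c' = w :: q ∧ barD m a c c' ≠ 0 ∧
    IsLeast {j : Fin n | w.1 j ≠ 0} i ∧ x.1 = Finsupp.single i 1 ∧ w.1 = x.1 + w'.1

/-- With `p = [w₁|…|w_{j-1}]` and `q = [w_{j+1}|…|w_l]`: the monomial `u` divides `w`, the cell
`[p|u|w/u|q]` belongs to `S`, and for no proper divisor `v` of `u` does `[p|v|w/v|q]` belong
to `S`. -/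
def IsSplitting (S : Set (Cell m a)) (p : Cell m a) (w : StdMon m a) (q : Cell m a)
    (u : StdMon m a) : Prop :=
  (∃ u' : StdMon m a, w.1 = u.1 + u'.1 ∧ p ++ u :: u' :: q ∈ S) ∧
  ∀ v v' : StdMon m a, v.1 ≤ u.1 → v ≠ u → w.1 = v.1 + v'.1 → p ++ v :: v' :: q ∉ S

/-- The matching in the coordinate position following the first `j` ones, on the cells in `S`: the
edges `[p|u₁|u₂|q] ⟶ [p|u₁u₂|q]` between cells of `S` such that `u₁` is maximal with respect to the
monomial order among the `u` as in `IsSplitting`. -/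
def laterMatching (j : ℕ) (S : Set (Cell m a)) (c c' : Cell m a) : Prop :=
  ∃ (p q : Cell m a) (u₁ u₂ w : StdMon m a),
    p.length = j ∧ c = p ++ u₁ :: u₂ :: q ∧ c' = p ++ w :: q ∧ w.1 = u₁.1 + u₂.1 ∧
    barD m a c c' ≠ 0 ∧ c ∈ S ∧ c' ∈ S ∧
    IsSplitting m a S p w q u₁ ∧ ∀ u, IsSplitting m a S p w q u → u.1 ≼[m] u₁.1

/-- The matching in coordinate position `j + 1`, if `S` is the set of cells that are critical after
the positions `1, …, j`. -/
def matchingAt : ℕ → Set (Cell m a) → Cell m a → Cell m a → Prop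
  | 0, _ => firstMatching m a
  | j + 1, S => laterMatching m a (j + 1) S

/-- The cells that are critical after the matchings in the coordinate positions `1, …, j`. -/
def remaining : ℕ → Set (Cell m a)
  | 0 => Set.univ
  | j + 1 => {c ∈ remaining j |
      AlgMorse.IsCritical (matchingAt m a j (remaining j)) c}

/-- The union `ℳ` of all these matchings. -/
def matching (c c' : Cell m a) : Prop :=
  ∃ j, matchingAt m a j (remaining m a j) c c'

/-! ## The resolution -/

/-- The module `F_i`: the degree `i` part of the Morse complex of the normalized bar resolution with
respect to `ℳ`. -/
abbrev F (i : ℕ) : Type _ :=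
  AlgMorse.MorseModule (QuotAlg a) (matching m a) List.length i

/-- The differential `F_{i+1} → F_i`. -/
def dF (i : ℕ) : F m a (i + 1) →ₗ[QuotAlg a] F m a i :=
  AlgMorse.morseD (barD m a) (matching m a) List.length i

/-- The augmentation `F_0 → k = A/⟨x₁,…,x_n⟩`, sending the basis element `[]` to `1`. -/
def augF : F m a 0 →ₗ[QuotAlg a] (QuotAlg a ⧸ maxIdeal a) :=
  Finsupp.linearCombination (QuotAlg a) fun _ => 1

end CommAnick

end

/-! Discrete Morse theory shrinks the bar resolution along an acyclic matching. The theorem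
therefore rests on a workable description of the matching, a termination argument for the paths,
exactness of the bar resolution, and a degree count for minimality.

The matching is a scan of the cell from the left (`LetterMatching`, `matching_eq`). Its state is a
set L of admissible letters, initially all of them. If x_i is the least admissible letter of the
current entry w and w ≠ x_i, then the cell is the target of the edge that splits x_i off w. If w =
x_i, the letters admissible in the next entry are the l with x_i x_l nonstandard and the l < i in L.
If the next entry v contains none of these, then x_i v is standard because the Gröbner basis is
quadratic, and its least admissible letter is x_i, so the cell is a source. Hence every entry of a
critical cell is a variable.

Along the steps of the reversed graph a lexicographic quantity decreases (`wellFounded_step`): the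
product of all entries in the monomial order, then the sequence of letters read by the scan, then a
number that weighs the length against being a target. This gives acyclicity and, with finite
branching, the finiteness of paths.

The bar resolution is contracted by v[c] ↦ [v|c] for standard v (`homotopy_identity`). The map c ↦ ∑
Γ(c, e) e from the bar resolution to the Morse complex kills the sources and their differentials,
and it is a chain map (`projF_D`). Since ∂ is injective on the span of the sources, cycles of the
Morse complex lift to cycles of the bar resolution (`exists_lift_cycle`), and exactness descends.

For minimality, normal forms preserve the degree because the ideal is homogeneous. Thus the degree
of the product of the entries drops only when the first entry is taken out as a coefficient, and
that coefficient lies in the maximal ideal. A critical cell of homological degree i has product of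
degree i, so every path between critical cells of degrees i + 1 and i contains such a step
(`Gam_mem_maxIdeal`). -/

namespace AlgMorse

/-! ### Paths in the graph with reversed edges, and the sums Γ -/

section Paths

variable {C R : Type*} [CommRing R] {D : C → C →₀ R} {M : C → C → Prop}

theorem IsAcyclicMatching.finite_steps (hM : IsAcyclicMatching D M) (c : C) :
    {d | Step D M c d}.Finite := by
  refine ((D c).support.finite_toSet.union (t := {d | M d c}) (Set.Subsingleton.finite ?_)).subset ?_
  · intro d hd d' hd'
    exact (hM.matching c d c d' c hd hd' (.inr rfl) (.inr rfl)).1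
  · rintro d (⟨h, -⟩ | h)
    · exact .inl (by simpa using h)
    · exact .inr h

/-- The paths in `G_M` from `c` to `e`. -/
def pathSet (D : C → C →₀ R) (M : C → C → Prop) (c e : C) : Set (List C) :=
  {p : List C | IsPath D M p ∧ p.head? = some c ∧ p.getLast? = some e}

theorem cons_cons_mem_pathSet {c d e x : C} {p : List C} :
    x :: d :: p ∈ pathSet D M c e ↔ x = c ∧ Step D M c d ∧ d :: p ∈ pathSet D M d e := by
  simp only [pathSet, IsPath, Set.mem_ofPred_eq, List.isChain_cons_cons, List.head?_cons,
    Option.some.injEq, List.getLast?_cons_cons, true_and]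
  constructor
  · rintro ⟨⟨h1, h2⟩, rfl, h3⟩
    exact ⟨rfl, h1, h2, h3⟩
  · rintro ⟨rfl, h1, h2, h3⟩
    exact ⟨⟨h1, h2⟩, rfl, h3⟩

/-- König's argument: each cell has finitely many successors and no infinite path exists, so
well-founded induction along the steps applies. -/
theorem finite_paths (hM : IsAcyclicMatching D M)
    (hwf : WellFounded (Function.swap (Step D M))) (c : C) :
    {p | IsPath D M p ∧ p.head? = some c}.Finite := by
  induction c using hwf.induction with
  | _ c ih =>
    refine ((Set.finite_singleton [c]).union ((hM.finite_steps c).biUnion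
      (t := fun d => List.cons c '' {p | IsPath D M p ∧ p.head? = some d})
      fun d hd => (ih d hd).image _)).subset ?_
    rintro p ⟨hp, hc⟩
    match p, hp, hc with
    | [x], _, hc =>
      obtain rfl : x = c := by simpa using hc
      exact .inl rfl
    | x :: d :: p, hp, hc =>
      obtain rfl : x = c := by simpa using hc
      have hp := List.isChain_cons_cons.1 hp
      exact .inr (Set.mem_biUnion hp.1 ⟨d :: p, ⟨hp.2, rfl⟩, rfl⟩)

theorem finite_pathSet (hM : IsAcyclicMatching D M)
    (hwf : WellFounded (Function.swap (Step D M))) (c e : C) : (pathSet D M c e).Finite :=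
  (finite_paths hM hwf c).subset fun _ hp => ⟨hp.1, hp.2.1⟩

open Classical in
theorem pathSet_eq (c e : C) :
    pathSet D M c e = (if c = e then {[c]} else ∅) ∪
      ⋃ d ∈ {d | Step D M c d}, List.cons c '' pathSet D M d e := by
  ext p
  simp only [Set.mem_union, Set.mem_iUnion, Set.mem_ofPred_eq, Set.mem_image, exists_prop]
  constructor
  · intro hp
    match p, hp with
    | [], hp => simp [pathSet] at hp
    | [x], hp =>
      left
      obtain ⟨-, h1, h2⟩ := hp
      obtain rfl : x = c := by simpa using h1
      obtain rfl : x = e := by simpa using h2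
      simp
    | x :: d :: p, hp =>
      obtain ⟨rfl, h1, h2⟩ := cons_cons_mem_pathSet.1 hp
      exact .inr ⟨d, h1, _, h2, rfl⟩
  · rintro (hp | ⟨d, hd, p, hp, rfl⟩)
    · split_ifs at hp with h
      · obtain rfl := h
        obtain rfl := hp
        simp [pathSet, IsPath]
      · exact hp.elim
    · match p, hp with
      | [], hp => simp [pathSet] at hp
      | x :: p, hp =>
        obtain rfl : x = d := by simpa using hp.2.1
        exact cons_cons_mem_pathSet.2 ⟨rfl, hd, hp⟩

open Classical in
/-- Splitting a path at its first step. -/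
theorem Gam_eq (hM : IsAcyclicMatching D M)
    (hwf : WellFounded (Function.swap (Step D M))) (c e : C) :
    Gam D M c e = (if c = e then 1 else 0) +
      ∑ d ∈ (hM.finite_steps c).toFinset, stepWeight D M c d * Gam D M d e := by
  change ∑ᶠ p ∈ pathSet D M c e, pathWeight D M p = _
  have hfin : ∀ d, (List.cons c '' pathSet D M d e).Finite :=
    fun d => (finite_pathSet hM hwf d e).image _
  have hhead : ∀ {d p}, p ∈ pathSet D M d e → ∃ p', p = d :: p' := by
    rintro d p ⟨-, hp, -⟩
    cases p with
    | nil => simp at hp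
    | cons x p => exact ⟨p, by simpa using hp⟩
  rw [pathSet_eq, finsum_mem_union]
  · congr 1
    · split_ifs
      · rw [finsum_mem_singleton]
        rfl
      · rw [finsum_mem_empty]
    · rw [finsum_mem_biUnion _ (hM.finite_steps c) fun d _ => hfin d,
        finsum_mem_eq_finite_toFinset_sum _ (hM.finite_steps c)]
      · refine Finset.sum_congr rfl fun d _ => ?_
        rw [finsum_mem_image (List.cons_injective.injOn)]
        change _ = _ * ∑ᶠ p ∈ pathSet D M d e, pathWeight D M p
        rw [finsum_mem_eq_finite_toFinset_sum _ (finite_pathSet hM hwf d e),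
          finsum_mem_eq_finite_toFinset_sum _ (finite_pathSet hM hwf d e), Finset.mul_sum]
        refine Finset.sum_congr rfl fun p hp => ?_
        obtain ⟨p, rfl⟩ := hhead ((Set.Finite.mem_toFinset _).1 hp)
        rfl
      · intro d _ d' _ hne
        refine Set.disjoint_left.2 ?_
        rintro _ ⟨p, hp, rfl⟩ ⟨p', hp', h⟩
        obtain ⟨q, rfl⟩ := hhead hp
        obtain ⟨q', rfl⟩ := hhead hp'
        simp only [List.cons.injEq, true_and] at h
        exact hne h.1.symm
  · refine Set.disjoint_left.2 fun p hp hp' => ?_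
    simp only [Set.mem_iUnion, Set.mem_image, exists_prop] at hp'
    obtain ⟨d, -, p, hp', rfl⟩ := hp'
    obtain ⟨q, rfl⟩ := hhead hp'
    split_ifs at hp
    · simp at hp
    · exact hp
  · split_ifs
    · exact Set.finite_singleton _
    · exact Set.finite_empty
  · exact (hM.finite_steps c).biUnion fun d _ => hfin d

/-- Each of the finitely many paths has only one end. This makes the `finsum` over critical cells in
the Morse differential a genuine sum rather than the default value 0. -/
theorem finite_Gam_ne_zero (hM : IsAcyclicMatching D M)
    (hwf : WellFounded (Function.swap (Step D M))) (c : C) : {e | Gam D M c e ≠ 0}.Finite := by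
  have hfin : (⋃ p ∈ {p | IsPath D M p ∧ p.head? = some c}, {e | p.getLast? = some e}).Finite := by
    refine (finite_paths hM hwf c).biUnion fun p _ => Set.Subsingleton.finite fun x hx y hy => ?_
    exact Option.some_injective _ (hx.symm.trans hy)
  refine hfin.subset fun e he => ?_
  contrapose! he
  simp only [Set.mem_iUnion, Set.mem_ofPred_eq, exists_prop, not_exists, not_and] at he
  simp only [Set.mem_ofPred_eq, not_not]
  refine finsum_mem_eq_zero_of_forall_eq_zero ?_
  rintro p ⟨h1, h2, h3⟩
  exact (he p ⟨h1, h2⟩ h3).elim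

/-- If `t` is smaller at the end of a path than at its start, some step of the path lowers `t`, and
the weight of that step is a factor in `I`. -/
theorem pathWeight_mem {I : Ideal R} {t : C → ℕ}
    (hI : ∀ c d, Step D M c d → t d < t c → stepWeight D M c d ∈ I) :
    ∀ (p : List C) (c e : C), p ∈ pathSet D M c e → t e < t c → pathWeight D M p ∈ I
  | [], _, _, hp, _ => by simp [pathSet] at hp
  | [x], c, e, hp, h => by
    obtain ⟨-, h1, h2⟩ := hp
    obtain rfl : x = c := by simpa using h1
    obtain rfl : x = e := by simpa using h2
    exact (lt_irrefl _ h).elim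
  | x :: d :: p, c, e, hp, h => by
    obtain ⟨rfl, h1, h2⟩ := cons_cons_mem_pathSet.1 hp
    by_cases hd : t d < t x
    · exact I.mul_mem_right _ (hI x d h1 hd)
    · exact I.mul_mem_left _ (pathWeight_mem hI (d :: p) d e h2 (by omega))

theorem Gam_mem {I : Ideal R} {t : C → ℕ}
    (hI : ∀ c d, Step D M c d → t d < t c → stepWeight D M c d ∈ I) {c e : C} (h : t e < t c) :
    Gam D M c e ∈ I :=
  finsum_mem_induction (· ∈ I) I.zero_mem (fun _ _ => I.add_mem)
    fun p hp => pathWeight_mem hI p c e hp h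

end Paths

/-! ### The Morse complex: projection from the based complex and descent of exactness -/

section MorseComplex

variable {C R : Type*} [CommRing R] {D : C → C →₀ R} {M : C → C → Prop} {deg : C → ℕ}

/-- The source of a matching edge is not critical and is not the target of one. -/
theorem IsAcyclicMatching.not_target (hM : IsAcyclicMatching D M) {a b : C} (h : M a b) (c : C) :
    ¬ M c a := by
  intro h'
  obtain ⟨rfl, rfl⟩ := hM.matching a a b c a h h' (.inl rfl) (.inr rfl)
  exact hM.acyclic _ (.single (.inr h))

theorem IsAcyclicMatching.source_unique (hM : IsAcyclicMatching D M) {a a' b : C}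
    (h : M a b) (h' : M a' b) : a' = a :=
  (hM.matching b a' b a b h' h (.inr rfl) (.inr rfl)).1

theorem IsAcyclicMatching.target_unique (hM : IsAcyclicMatching D M) {a b b' : C}
    (h : M a b) (h' : M a b') : b' = b :=
  (hM.matching a a b' a b h' h (.inl rfl) (.inl rfl)).2

theorem Step.deg_cases (hM : IsAcyclicMatching D M)
    (hdeg : ∀ c d, D c d ≠ 0 → deg c = deg d + 1) {c d : C} (h : Step D M c d) :
    (deg c = deg d + 1 ∧ D c d ≠ 0 ∧ ¬ M c d) ∨ (deg d = deg c + 1 ∧ M d c) := by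
  rcases h with h | h
  · exact .inl ⟨hdeg _ _ h.1, h⟩
  · exact .inr ⟨hdeg _ _ (hM.edge _ _ h), h⟩

/-- A reversed edge ends in a source, which is neither the critical cell `e` nor a target, so the
next step must go down again. A path that begins below the degree of `e`, or in that degree at a
cell other than `e` that is no target, can therefore never arrive at `e`. -/
theorem Gam_eq_zero (hM : IsAcyclicMatching D M) (hwf : WellFounded (Function.swap (Step D M)))
    (hdeg : ∀ c d, D c d ≠ 0 → deg c = deg d + 1) {e : C} (he : IsCritical M e) (c : C)
    (hc : deg c < deg e ∨ deg c = deg e ∧ c ≠ e ∧ ∀ a, ¬ M a c) : Gam D M c e = 0 := by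
  induction c using hwf.induction with
  | _ c ih =>
    have hne : c ≠ e := by
      rintro rfl
      rcases hc with h | h
      · exact lt_irrefl _ h
      · exact h.2.1 rfl
    rw [Gam_eq hM hwf, if_neg hne, zero_add]
    refine Finset.sum_eq_zero fun d hd => ?_
    have hd : Step D M c d := by simpa using hd
    rw [ih d hd, mul_zero]
    rcases Step.deg_cases hM hdeg hd with ⟨h1, -⟩ | ⟨h1, h2⟩
    · left
      rcases hc with h | h <;> omega
    · rcases hc with h | h
      · rcases (show deg d ≤ deg e by omega).lt_or_eq with h' | h'
        · exact .inl h'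
        · refine .inr ⟨h', ?_, hM.not_target h2⟩
          rintro rfl
          exact (he c).1 h2
      · exact (h.2.2 _ h2).elim

theorem Gam_self (hM : IsAcyclicMatching D M) (hwf : WellFounded (Function.swap (Step D M)))
    (hdeg : ∀ c d, D c d ≠ 0 → deg c = deg d + 1) {e : C} (he : IsCritical M e) :
    Gam D M e e = 1 := by
  rw [Gam_eq hM hwf, if_pos rfl, add_eq_left]
  refine Finset.sum_eq_zero fun d hd => ?_
  have hd : Step D M e d := by simpa using hd
  rcases Step.deg_cases hM hdeg hd with ⟨h1, -⟩ | ⟨h1, h2⟩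
  · rw [Gam_eq_zero hM hwf hdeg he d (.inl (by omega)), mul_zero]
  · exact ((he d).2 h2).elim

open Classical in
/-- From a cell that is not the target of a matching edge all steps are downward. -/
theorem Gam_eq_of_not_target (hM : IsAcyclicMatching D M)
    (hwf : WellFounded (Function.swap (Step D M))) {c e : C} (hne : c ≠ e)
    (hc : ∀ a, ¬ M a c) :
    Gam D M c e = ∑ d ∈ (D c).support with ¬ M c d, D c d * Gam D M d e := by
  rw [Gam_eq hM hwf, if_neg hne, zero_add]
  refine Finset.sum_congr ?_ fun d _ => ?_
  · ext d
    simp [Step, hc d]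
  · rw [stepWeight, if_neg (hc d)]

variable (D M) in
/-- The linear extension of `c ↦ Γ(c, e)`. -/
noncomputable def gamL (e : C) : (C →₀ R) →ₗ[R] R :=
  Finsupp.linearCombination R fun c => Gam D M c e

@[simp]
theorem gamL_single (e c : C) (r : R) : gamL D M e (Finsupp.single c r) = r * Gam D M c e := by
  simp [gamL]

theorem gamL_D (e c : C) :
    gamL D M e (D c) = ∑ d ∈ (D c).support, D c d * Gam D M d e := by
  simp [gamL, Finsupp.linearCombination_apply, Finsupp.sum]

theorem gamL_D_of_isCritical (hM : IsAcyclicMatching D M)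
    (hwf : WellFounded (Function.swap (Step D M))) {c e : C} (hne : c ≠ e)
    (hc : IsCritical M c) : gamL D M e (D c) = Gam D M c e := by
  classical
  rw [Gam_eq_of_not_target hM hwf hne fun a => (hc a).2, gamL_D]
  refine Finset.sum_congr ?_ fun _ _ => rfl
  ext d
  simp [(hc d).1]

/-- Among the steps from `b` only the reversed edge to `a` can lead to `e`, so Γ(b, e) = -[a : b]⁻¹
Γ(a, e). On the other hand Γ(a, e) is the sum of [a : d] Γ(d, e) over d ≠ b. The two cancel in the
sum over all d. -/
theorem gamL_D_of_source (hM : IsAcyclicMatching D M)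
    (hwf : WellFounded (Function.swap (Step D M)))
    (hdeg : ∀ c d, D c d ≠ 0 → deg c = deg d + 1) {e : C} (he : IsCritical M e) {a b : C}
    (hab : M a b) (ha : deg a = deg e + 1) : gamL D M e (D a) = 0 := by
  classical
  have hD := hM.edge a b hab
  have hb := hdeg a b hD
  have hbe : b ≠ e := by
    rintro rfl
    exact (he a).2 hab
  have hae : a ≠ e := by
    rintro rfl
    exact (he b).1 hab
  have h1 : Gam D M b e = - Ring.inverse (D a b) * Gam D M a e := by
    rw [Gam_eq hM hwf b, if_neg hbe, zero_add, Finset.sum_eq_single a, stepWeight, if_pos hab]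
    · intro d hd hda
      have hd : Step D M b d := by simpa using hd
      rcases Step.deg_cases hM hdeg hd with ⟨h1, -⟩ | ⟨-, h2⟩
      · rw [Gam_eq_zero hM hwf hdeg he d (.inl (by omega)), mul_zero]
      · exact (hda (hM.source_unique hab h2)).elim
    · intro h
      exact (h ((Set.Finite.mem_toFinset _).2 (.inr hab))).elim
  have h2 := Gam_eq_of_not_target hM hwf hae (hM.not_target hab)
  have h3 : (D a).support.filter (fun d => ¬ M a d) = (D a).support.erase b := by
    ext d
    simp only [Finset.mem_filter, Finset.mem_erase, and_comm]
    refine and_congr_left fun _ => not_congr ⟨fun h => hM.target_unique hab h, ?_⟩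
    rintro rfl
    exact hab
  rw [h3] at h2
  rw [gamL_D, ← Finset.add_sum_erase _ _ (Finsupp.mem_support_iff.2 hD), ← h2, h1, ← mul_assoc,
    mul_neg, Ring.mul_inverse_cancel _ (hM.invertible a b hab)]
  ring

variable (D M) in
/-- The differential of the based complex. -/
noncomputable def totalD : (C →₀ R) →ₗ[R] (C →₀ R) := Finsupp.linearCombination R D

@[simp]
theorem totalD_single (c : C) (r : R) : totalD D (Finsupp.single c r) = r • D c := by
  simp [totalD]

/-- The inclusion of the span of the critical cells. -/
noncomputable def inclF (M : C → C → Prop) (deg : C → ℕ) (i : ℕ) :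
    MorseModule R M deg i →ₗ[R] (C →₀ R) := Finsupp.lmapDomain R R Subtype.val

@[simp]
theorem inclF_single (i : ℕ) (e : CriticalCell M deg i) (r : R) :
    inclF M deg i (Finsupp.single e r) = Finsupp.single e.1 r := by
  simp [inclF]

variable (D M deg) in
/-- The projection `c ↦ ∑ Γ(c, e) e` of the based complex to its Morse complex. -/
noncomputable def projF (i : ℕ) : (C →₀ R) →ₗ[R] MorseModule R M deg i :=
  Finsupp.linearCombination R fun c : C =>
    ∑ᶠ e : CriticalCell M deg i, Finsupp.single e (Gam D M c e.1)

theorem finsum_single_apply {E : Type*} (g : E → R) (hg : g.support.Finite) (e : E) :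
    (∑ᶠ e', Finsupp.single e' (g e')) e = g e := by
  classical
  rw [finsum_eq_sum_of_support_subset (s := hg.toFinset), Finset.sum_apply']
  · by_cases h : g e = 0 <;> simp [Finsupp.single_apply, h]
  · intro x hx
    simpa using hx

theorem projF_single_apply (hM : IsAcyclicMatching D M)
    (hwf : WellFounded (Function.swap (Step D M))) (i : ℕ) (c : C) (r : R)
    (e : CriticalCell M deg i) :
    projF D M deg i (Finsupp.single c r) e = r * Gam D M c e.1 := by
  rw [projF, Finsupp.linearCombination_single, Finsupp.smul_apply, smul_eq_mul,
    finsum_single_apply (fun e : CriticalCell M deg i => Gam D M c e.1)]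
  exact (finite_Gam_ne_zero hM hwf c).preimage Subtype.val_injective.injOn

theorem projF_apply (hM : IsAcyclicMatching D M)
    (hwf : WellFounded (Function.swap (Step D M))) (i : ℕ) (x : C →₀ R)
    (e : CriticalCell M deg i) : projF D M deg i x e = gamL D M e.1 x := by
  induction x using Finsupp.induction_linear with
  | zero => simp
  | add x y hx hy => simp [hx, hy]
  | single c r => rw [projF_single_apply hM hwf, gamL_single]

theorem morseD_single (i : ℕ) (c : CriticalCell M deg (i + 1)) (r : R) :
    morseD D M deg i (Finsupp.single c r) = projF D M deg i (Finsupp.single c.1 r) := by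
  simp [morseD, projF]

/-- A critical cell lies on no matching edge, so the first steps from it are exactly the terms of
its differential. -/
theorem morseD_eq (hM : IsAcyclicMatching D M) (hwf : WellFounded (Function.swap (Step D M)))
    (i : ℕ) (z : MorseModule R M deg (i + 1)) :
    morseD D M deg i z = projF D M deg i (totalD D (inclF M deg (i + 1) z)) := by
  induction z using Finsupp.induction_linear with
  | zero => simp
  | add x y hx hy => simp [hx, hy]
  | single c r =>
    ext e
    have hne : c.1 ≠ e.1 := fun h => by
      have h1 := c.2.2
      rw [h, e.2.2] at h1
      omega
    rw [morseD_single, projF_single_apply hM hwf, inclF_single, totalD_single, map_smul,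
      Finsupp.smul_apply, projF_apply hM hwf, gamL_D_of_isCritical hM hwf hne c.2.1, smul_eq_mul]

theorem projF_inclF (hM : IsAcyclicMatching D M) (hwf : WellFounded (Function.swap (Step D M)))
    (hdeg : ∀ c d, D c d ≠ 0 → deg c = deg d + 1) (i : ℕ) (z : MorseModule R M deg i) :
    projF D M deg i (inclF M deg i z) = z := by
  classical
  induction z using Finsupp.induction_linear with
  | zero => simp
  | add x y hx hy => simp [hx, hy]
  | single c r =>
    ext e
    rw [inclF_single, projF_single_apply hM hwf]
    by_cases h : c = e
    · subst h
      rw [Gam_self hM hwf hdeg c.2.1]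
      simp
    · rw [Gam_eq_zero hM hwf hdeg e.2.1, mul_zero, Finsupp.single_eq_of_ne (Ne.symm h)]
      exact .inr ⟨c.2.2.trans e.2.2.symm, fun h' => h (Subtype.ext h'), fun a => (c.2.1 a).2⟩

/-- The span of the cells of degree `i`. -/
abbrev degPart (R : Type*) [CommRing R] {C : Type*} (deg : C → ℕ) (i : ℕ) : Submodule R (C →₀ R) :=
  Finsupp.supported R R {c | deg c = i}

/-- The span of the sources of degree `i` of matching edges. -/
abbrev sourcePart (R : Type*) [CommRing R] {C : Type*} (M : C → C → Prop) (deg : C → ℕ) (i : ℕ) :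
    Submodule R (C →₀ R) :=
  Finsupp.supported R R {c | deg c = i ∧ ∃ b, M c b}

theorem sourcePart_le_degPart (i : ℕ) : sourcePart R M deg i ≤ degPart R deg i :=
  Finsupp.supported_mono fun _ h => h.1

theorem inclF_mem (i : ℕ) (z : MorseModule R M deg i) : inclF M deg i z ∈ degPart R deg i := by
  induction z using Finsupp.induction_linear with
  | zero => simp
  | add x y hx hy => simpa using add_mem hx hy
  | single c r =>
    rw [inclF_single]
    exact Finsupp.single_mem_supported R r c.2.2

/-- Induction on the elements of the span of a set of cells. -/
theorem supported_induction {s : Set C} {p : (C →₀ R) → Prop} (h0 : p 0)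
    (hadd : ∀ x y, p x → p y → p (x + y)) (hs : ∀ c ∈ s, ∀ r, p (Finsupp.single c r))
    {x : C →₀ R} (hx : x ∈ Finsupp.supported R R s) : p x := by
  rw [← Finsupp.sum_single x]
  exact Finset.sum_induction _ p hadd h0 fun c hc => hs c (hx hc) _

theorem totalD_mem (hdeg : ∀ c d, D c d ≠ 0 → deg c = deg d + 1) {i : ℕ} {x : C →₀ R}
    (hx : x ∈ degPart R deg (i + 1)) : totalD D x ∈ degPart R deg i := by
  refine supported_induction (p := fun x => totalD D x ∈ degPart R deg i) ?_ ?_ ?_ hx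
  · simp
  · intro x y hx hy
    simpa using add_mem hx hy
  · intro c hc r
    rw [totalD_single]
    refine Submodule.smul_mem _ _ fun d hd => ?_
    have := hdeg c d (by simpa using hd)
    rw [Set.mem_ofPred_eq] at hc ⊢
    omega

theorem projF_eq_zero_of_source (hM : IsAcyclicMatching D M)
    (hwf : WellFounded (Function.swap (Step D M)))
    (hdeg : ∀ c d, D c d ≠ 0 → deg c = deg d + 1) {i : ℕ} {x : C →₀ R}
    (hx : x ∈ sourcePart R M deg i) : projF D M deg i x = 0 := by
  refine supported_induction (p := fun x => projF D M deg i x = 0) ?_ ?_ ?_ hx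
  · simp
  · intro x y hx hy
    simp [hx, hy]
  · rintro c ⟨hc, b, hb⟩ r
    ext e
    rw [projF_single_apply hM hwf, Gam_eq_zero hM hwf hdeg e.2.1, mul_zero, Finsupp.zero_apply]
    refine .inr ⟨hc.trans e.2.2.symm, ?_, hM.not_target hb⟩
    rintro rfl
    exact (e.2.1 b).1 hb

theorem projF_D_eq_zero_of_source (hM : IsAcyclicMatching D M)
    (hwf : WellFounded (Function.swap (Step D M)))
    (hdeg : ∀ c d, D c d ≠ 0 → deg c = deg d + 1) {i : ℕ} {x : C →₀ R}
    (hx : x ∈ sourcePart R M deg (i + 1)) : projF D M deg i (totalD D x) = 0 := by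
  refine supported_induction (p := fun x => projF D M deg i (totalD D x) = 0) ?_ ?_ ?_ hx
  · simp
  · intro x y hx hy
    simp [hx, hy]
  · rintro c ⟨hc, b, hb⟩ r
    ext e
    rw [totalD_single, map_smul, Finsupp.smul_apply, projF_apply hM hwf,
      gamL_D_of_source hM hwf hdeg e.2.1 hb (hc.trans (congrArg (· + 1) e.2.2.symm)), smul_zero,
      Finsupp.zero_apply]

/-- A submodule that contains the differentials of all sources of matching edges and all cells
other than targets of matching edges contains all cells. -/
theorem single_mem_of_targets (hM : IsAcyclicMatching D M)
    (hwf : WellFounded (Function.swap (Step D M)))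
    (hdeg : ∀ c d, D c d ≠ 0 → deg c = deg d + 1) {i : ℕ} {T : Submodule R (C →₀ R)}
    (h1 : ∀ c, deg c = i → (∀ a, ¬ M a c) → Finsupp.single c 1 ∈ T)
    (h2 : ∀ a, deg a = i + 1 → (∃ b, M a b) → D a ∈ T) :
    degPart R deg i ≤ T := by
  have key : ∀ c, deg c = i → Finsupp.single c (1 : R) ∈ T := by
    intro c
    induction c using hwf.transGen.induction with
    | _ c ih =>
      intro hc
      by_cases hac : ∃ a, M a c
      · obtain ⟨a, ha⟩ := hac
        have hD := hM.edge a c ha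
        have hda := hdeg a c hD
        -- Every other cell d of `D a` is reached from `c` by c → a → d, so the induction hypothesis
        -- covers it. What remains is [a : c] c, and the coefficient is a unit.
        have h3 : D a - (D a).erase c ∈ T := by
          refine T.sub_mem (h2 a (by omega) ⟨c, ha⟩) ?_
          rw [← Finsupp.sum_single ((D a).erase c)]
          refine T.sum_mem fun d hd => ?_
          have hd : d ≠ c ∧ D a d ≠ 0 := by
            refine ⟨fun h => ?_, fun h => ?_⟩
            · rw [h, Finsupp.mem_support_iff, Finsupp.erase_same] at hd
              exact hd rfl
            · rw [Finsupp.mem_support_iff] at hd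
              refine hd ?_
              by_cases hdc : d = c
              · rw [hdc, Finsupp.erase_same]
              · rw [Finsupp.erase_ne hdc, h]
          rw [← mul_one ((D a).erase c d), ← smul_eq_mul, ← Finsupp.smul_single]
          refine T.smul_mem _ (ih d ?_ ?_)
          · have s1 : Step D M c a := .inr ha
            have s2 : Step D M a d := .inl ⟨hd.2, fun h => hd.1 (hM.target_unique ha h)⟩
            exact Relation.TransGen.tail (b := a) (.single s2) s1
          · have := hdeg a d hd.2
            omega
        rw [← Finsupp.single_add_erase c (D a), Finsupp.erase_add, Finsupp.erase_single, zero_add,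
          Finsupp.erase_idem, add_sub_cancel_right] at h3
        have h4 := T.smul_mem (Ring.inverse (D a c)) h3
        rwa [Finsupp.smul_single, smul_eq_mul,
          Ring.inverse_mul_cancel _ (hM.invertible a c ha)] at h4
      · exact h1 c hc (by simpa using hac)
  intro x hx
  rw [← Finsupp.sum_single x]
  refine T.sum_mem fun c hc => ?_
  rw [← mul_one (x c), ← smul_eq_mul, ← Finsupp.smul_single]
  exact T.smul_mem _ (key c (hx hc))

/-- The projection is a chain map. By `single_mem_of_targets` this needs checking only on sources,
on critical cells and on differentials of sources. Both sides vanish on the first and third kind,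
and on critical cells the claim is `morseD_eq`. -/
theorem projF_D (hM : IsAcyclicMatching D M) (hwf : WellFounded (Function.swap (Step D M)))
    (hdeg : ∀ c d, D c d ≠ 0 → deg c = deg d + 1) (hDD : ∀ x, totalD D (totalD D x) = 0)
    {i : ℕ} {x : C →₀ R} (hx : x ∈ degPart R deg (i + 1)) :
    projF D M deg i (totalD D x) = morseD D M deg i (projF D M deg (i + 1) x) := by
  have hle := single_mem_of_targets (T := LinearMap.eqLocus (projF D M deg i ∘ₗ totalD D)
    (morseD D M deg i ∘ₗ projF D M deg (i + 1))) hM hwf hdeg (i := i + 1) ?_ ?_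
  · exact hle hx
  · intro c hc hcM
    change projF D M deg i (totalD D (Finsupp.single c 1)) =
      morseD D M deg i (projF D M deg (i + 1) (Finsupp.single c 1))
    by_cases hcrit : ∃ b, M c b
    · have hmem : Finsupp.single c (1 : R) ∈ sourcePart R M deg (i + 1) :=
        Finsupp.single_mem_supported R _ ⟨hc, hcrit⟩
      rw [projF_eq_zero_of_source hM hwf hdeg hmem,
        projF_D_eq_zero_of_source hM hwf hdeg hmem, map_zero]
    · have hcrit : IsCritical M c := fun b => ⟨fun h => hcrit ⟨b, h⟩, hcM b⟩
      have h := projF_inclF (R := R) (i := i + 1) hM hwf hdeg (Finsupp.single ⟨c, hcrit, hc⟩ 1)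
      rw [inclF_single] at h
      rw [h, morseD_eq hM hwf, inclF_single]
  · rintro a ha hb
    have hmem : Finsupp.single a (1 : R) ∈ sourcePart R M deg (i + 1 + 1) :=
      Finsupp.single_mem_supported R _ ⟨ha, hb⟩
    have h1 : totalD D (Finsupp.single a 1) = D a := by simp
    change projF D M deg i (totalD D (D a)) =
      morseD D M deg i (projF D M deg (i + 1) (D a))
    rw [← h1, hDD, projF_D_eq_zero_of_source hM hwf hdeg hmem, map_zero, map_zero]

/-- In each degree the complex is spanned by the critical cells, the sources, and the differentials
of sources one degree up. The projection keeps the first and kills the other two. -/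
theorem sub_projF_mem (hM : IsAcyclicMatching D M)
    (hwf : WellFounded (Function.swap (Step D M)))
    (hdeg : ∀ c d, D c d ≠ 0 → deg c = deg d + 1)
    {i : ℕ} {x : C →₀ R} (hx : x ∈ degPart R deg i) :
    x - inclF M deg i (projF D M deg i x) ∈
      sourcePart R M deg i ⊔ (sourcePart R M deg (i + 1)).map (totalD D) := by
  set N := sourcePart R M deg i ⊔ (sourcePart R M deg (i + 1)).map (totalD D) with hN
  have hle := single_mem_of_targets (T := N.comap
    (LinearMap.id - inclF M deg i ∘ₗ projF D M deg i)) hM hwf hdeg (i := i) ?_ ?_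
  · exact hle hx
  · intro c hc hcM
    rw [Submodule.mem_comap]
    change Finsupp.single c 1 - inclF M deg i (projF D M deg i (Finsupp.single c 1)) ∈ N
    by_cases hcrit : ∃ b, M c b
    · have hmem : Finsupp.single c (1 : R) ∈ sourcePart R M deg i :=
        Finsupp.single_mem_supported R _ ⟨hc, hcrit⟩
      rw [projF_eq_zero_of_source hM hwf hdeg hmem, map_zero, sub_zero]
      exact Submodule.mem_sup_left hmem
    · have hcrit : IsCritical M c := fun b => ⟨fun h => hcrit ⟨b, h⟩, hcM b⟩
      have h := projF_inclF (R := R) (i := i) hM hwf hdeg (Finsupp.single ⟨c, hcrit, hc⟩ 1)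
      rw [inclF_single] at h
      rw [h, inclF_single, sub_self]
      exact N.zero_mem
  · rintro a ha hb
    have hmem : Finsupp.single a (1 : R) ∈ sourcePart R M deg (i + 1) :=
      Finsupp.single_mem_supported R _ ⟨ha, hb⟩
    have h1 : totalD D (Finsupp.single a 1) = D a := by simp
    rw [Submodule.mem_comap]
    change D a - inclF M deg i (projF D M deg i (D a)) ∈ N
    rw [← h1, projF_D_eq_zero_of_source hM hwf hdeg hmem, map_zero, sub_zero]
    exact Submodule.mem_sup_right (Submodule.mem_map_of_mem hmem)

/-- The differential is injective on the span of the sources of matching edges. -/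
theorem eq_zero_of_source (hM : IsAcyclicMatching D M) {i : ℕ} {x : C →₀ R}
    (hx : x ∈ sourcePart R M deg i) (h0 : totalD D x = 0) : x = 0 := by
  classical
  by_contra hne
  let r : C → C → Prop := Relation.TransGen (Step D M)
  have : IsStrictOrder C r :=
    { irrefl := hM.acyclic, trans := fun _ _ _ => Relation.TransGen.trans }
  have : IsStrictOrder C (Function.swap r) :=
    { irrefl := hM.acyclic, trans := fun _ _ _ h h' => Relation.TransGen.trans h' h }
  -- The cell `a` is chosen in the support so that no path leads to it from another cell of the
  -- support. With `b` its partner, another a' with [a' : b] ≠ 0 would give the path a' → b → a.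
  -- Hence the coefficient of `b` in the differential of `x` is `x a` times a unit.
  obtain ⟨a, ha, hmax⟩ := (x.support.finite_toSet.wellFoundedOn (r := r)).has_min
    Set.univ ⟨⟨_, (Finsupp.support_nonempty_iff.2 hne).choose_spec⟩, trivial⟩
  obtain ⟨-, b, hb⟩ := hx a.2
  have hunit := hM.invertible _ _ hb
  have h1 : totalD D x b = x a.1 * D a.1 b := by
    rw [totalD, Finsupp.linearCombination_apply, Finsupp.sum, Finset.sum_apply',
      Finset.sum_eq_single a.1]
    · simp
    · intro a' ha' hne'
      have hz : D a' b = 0 := by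
        by_contra hD
        refine hmax ⟨a', ha'⟩ trivial ?_
        refine Relation.TransGen.tail (b := b) (.single (.inl ⟨hD, fun h => ?_⟩)) (.inr hb)
        exact hne' (hM.source_unique hb h)
      simp [hz]
    · intro h
      exact (h a.2).elim
  rw [h0, Finsupp.zero_apply, eq_comm, hunit.mul_left_eq_zero] at h1
  exact Finsupp.mem_support_iff.1 a.2 h1

/-- A cycle of the Morse complex lifts to a cycle of the based complex. -/
theorem exists_lift_cycle (hM : IsAcyclicMatching D M)
    (hwf : WellFounded (Function.swap (Step D M)))
    (hdeg : ∀ c d, D c d ≠ 0 → deg c = deg d + 1) (hDD : ∀ x, totalD D (totalD D x) = 0)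
    {i : ℕ} {z : MorseModule R M deg (i + 1)} (hz : morseD D M deg i z = 0) :
    ∃ x ∈ degPart R deg (i + 1), totalD D x = 0 ∧ projF D M deg (i + 1) x = z := by
  have h1 := sub_projF_mem hM hwf hdeg (totalD_mem hdeg (inclF_mem (i + 1) z))
  rw [← morseD_eq hM hwf, hz, map_zero, sub_zero] at h1
  -- The differential of the included `z` has projection zero, hence equals s + ∂s' with s and s' in
  -- spans of sources. Applying ∂ gives ∂s = 0, so s = 0, and subtracting s' turns the lift of `z`
  -- into a cycle without changing its projection.
  obtain ⟨s, hs, t, ht, hst⟩ := Submodule.mem_sup.1 h1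
  obtain ⟨s', hs', rfl⟩ := Submodule.mem_map.1 ht
  have h2 := congrArg (totalD D) hst
  rw [map_add, hDD, hDD, add_zero] at h2
  obtain rfl := eq_zero_of_source hM hs h2
  refine ⟨inclF M deg (i + 1) z - s',
    sub_mem (inclF_mem _ _) (sourcePart_le_degPart _ hs'), ?_, ?_⟩
  · rw [map_sub, ← hst, zero_add, sub_self]
  · rw [map_sub, projF_inclF hM hwf hdeg, projF_eq_zero_of_source hM hwf hdeg hs', sub_zero]

/-- A Morse cycle lifts to a cycle of the based complex, which bounds there, and the projection of a
bounding chain bounds the original cycle. -/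
theorem exact_morseD (hM : IsAcyclicMatching D M)
    (hwf : WellFounded (Function.swap (Step D M)))
    (hdeg : ∀ c d, D c d ≠ 0 → deg c = deg d + 1) (hDD : ∀ x, totalD D (totalD D x) = 0)
    (i : ℕ) (hex : ∀ x ∈ degPart R deg (i + 1), totalD D x = 0 →
      ∃ y ∈ degPart R deg (i + 2), totalD D y = x) :
    Function.Exact (morseD D M deg (i + 1)) (morseD D M deg i) := by
  intro z
  constructor
  · intro hz
    obtain ⟨x, hx, hx0, rfl⟩ := exists_lift_cycle hM hwf hdeg hDD hz
    obtain ⟨y, hy, rfl⟩ := hex x hx hx0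
    exact ⟨_, (projF_D hM hwf hdeg hDD hy).symm⟩
  · rintro ⟨y, rfl⟩
    rw [morseD_eq hM hwf (i + 1), ← projF_D hM hwf hdeg hDD (totalD_mem hdeg (inclF_mem _ _)), hDD,
      map_zero]

theorem mem_smul_top_of_forall_mem {E : Type*} (I : Ideal R) (z : E →₀ R) (hz : ∀ e, z e ∈ I) :
    z ∈ I • (⊤ : Submodule R (E →₀ R)) := by
  rw [← Finsupp.sum_single z]
  refine Submodule.sum_mem _ fun e _ => ?_
  rw [← mul_one (z e), ← smul_eq_mul, ← Finsupp.smul_single]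
  exact Submodule.smul_mem_smul (hz e) trivial

theorem range_morseD_le (hM : IsAcyclicMatching D M)
    (hwf : WellFounded (Function.swap (Step D M))) (I : Ideal R) (i : ℕ)
    (hI : ∀ (c : CriticalCell M deg (i + 1)) (e : CriticalCell M deg i), Gam D M c.1 e.1 ∈ I) :
    LinearMap.range (morseD D M deg i) ≤ I • (⊤ : Submodule R (MorseModule R M deg i)) := by
  rintro _ ⟨z, rfl⟩
  induction z using Finsupp.induction_linear with
  | zero => simp
  | add x y hx hy => simpa using add_mem hx hy
  | single c r =>
    refine mem_smul_top_of_forall_mem I _ fun e => ?_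
    rw [morseD_single, projF_single_apply hM hwf]
    exact I.mul_mem_left _ (hI c e)

end MorseComplex

end AlgMorse

namespace CommAnick

variable {k : Type*} [Field k] {n : ℕ}

/-! ### Standard monomials and normal forms for a quadratic Gröbner basis -/

section Groebner

variable {m : MonomialOrder (Fin n)} {a : Ideal (MvPolynomial (Fin n) k)}

theorem sub_normalForm_mem (m : MonomialOrder (Fin n)) (a : Ideal (MvPolynomial (Fin n) k))
    (f : MvPolynomial (Fin n) k) : f - normalForm m a f ∈ a :=
  (exists_normalForm m a f).choose_spec.1

theorem IsStandard.of_mem_support {f : MvPolynomial (Fin n) k} {v : Fin n →₀ ℕ}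
    (hv : v ∈ (normalForm m a f).support) : IsStandard m a v :=
  (exists_normalForm m a f).choose_spec.2 v hv

theorem IsStandard.mono {u v : Fin n →₀ ℕ} (hv : IsStandard m a v) (h : u ≤ v) :
    IsStandard m a u := by
  intro f hf hf0 hd
  have hm : MvPolynomial.monomial (v - u) (1 : k) ≠ 0 := by simp
  refine hv (f * MvPolynomial.monomial (v - u) 1) (a.mul_mem_right _ hf) (mul_ne_zero hf0 hm) ?_
  classical
  rw [m.degree_mul hf0 hm, m.degree_monomial, if_neg one_ne_zero, hd, add_tsub_cancel_of_le h]

theorem normalForm_monomial {v : Fin n →₀ ℕ} (hv : IsStandard m a v) :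
    normalForm m a (MvPolynomial.monomial v (1 : k)) = MvPolynomial.monomial v 1 := by
  refine (eq_normalForm m a _ _ (by simp) fun u hu => ?_).symm
  obtain rfl : u = v := by simpa using MvPolynomial.support_monomial_subset hu
  exact hv

/-- For nonstandard `u` the leading monomial of `u` minus its normal form is nonstandard, since this
difference lies in the ideal. It cannot come from the normal form, so it is `u`, and all other terms
lie below. -/
theorem eq_or_lt_of_mem_support_normalForm {u v : Fin n →₀ ℕ}
    (hv : v ∈ (normalForm m a (MvPolynomial.monomial u (1 : k))).support) : v = u ∨ v ≺[m] u := by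
  classical
  by_cases hu : IsStandard m a u
  · rw [normalForm_monomial hu] at hv
    exact .inl (by simpa using MvPolynomial.support_monomial_subset hv)
  · right
    set r := normalForm m a (MvPolynomial.monomial u (1 : k)) with hr
    set f := MvPolynomial.monomial u (1 : k) - r with hf
    have hru : r.coeff u = 0 := by
      by_contra h
      exact hu (IsStandard.of_mem_support (MvPolynomial.mem_support_iff.2 h))
    have hfu : f.coeff u ≠ 0 := by simp [hf, hru]
    have hf0 : f ≠ 0 := fun h => hfu (by simp [h])
    have hfd : m.degree f = u := by
      have h1 := MvPolynomial.support_sub (Fin n) _ _ (m.degree_mem_support hf0)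
      rcases Finset.mem_union.1 h1 with h | h
      · simpa using MvPolynomial.support_monomial_subset h
      · exact ((IsStandard.of_mem_support h) f (sub_normalForm_mem m a _) hf0 rfl).elim
    have hvu : v ≠ u := by
      rintro rfl
      exact MvPolynomial.mem_support_iff.1 hv hru
    have hvf : v ∈ f.support := by
      rw [MvPolynomial.mem_support_iff] at hv ⊢
      simpa [hf, MvPolynomial.coeff_monomial, hvu.symm] using hv
    have hle := m.le_degree hvf
    rw [hfd] at hle
    exact lt_of_le_of_ne hle fun h => hvu (m.toSyn.injective h)

theorem not_isStandard_iff {B : Set (MvPolynomial (Fin n) k)} (hB : IsGroebnerBasis m B a)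
    {v : Fin n →₀ ℕ} : ¬ IsStandard m a v ↔ ∃ b ∈ B, b ≠ 0 ∧ m.degree b ≤ v := by
  constructor
  · intro h
    simp only [IsStandard, not_forall, not_not] at h
    obtain ⟨f, hf, hf0, rfl⟩ := h
    have h1 : m.leadingTerm f ∈ Ideal.span (m.leadingTerm '' B) := by
      rw [hB.2]
      exact Ideal.subset_span ⟨f, hf, rfl⟩
    rw [m.span_leadingTerm_eq_span_monomial', ← Set.image_image (fun s => MvPolynomial.monomial s 1),
      MvPolynomial.mem_ideal_span_monomial_image] at h1
    obtain ⟨_, ⟨b, ⟨hb, hb0⟩, rfl⟩, h⟩ := h1 (m.degree f) (by simp [m.support_leadingTerm' hf0])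
    exact ⟨b, hb, hb0, h⟩
  · rintro ⟨b, hb, hb0, h⟩ hv
    exact hv.mono h b (hB.1 hb) hb0 rfl

/-- Division by the nonzero elements of `B` leaves a remainder in the ideal none of whose terms is
divisible by a leading monomial of `B`, so the remainder is zero. -/
theorem IsGroebnerBasis.span_eq {B : Set (MvPolynomial (Fin n) k)} (hB : IsGroebnerBasis m B a) :
    Ideal.span B = a := by
  refine le_antisymm (Ideal.span_le.2 hB.1) fun f hf => ?_
  obtain ⟨g, r, hfr, -, hr⟩ := MonomialOrder.div_set (m := m) (B := {b | b ∈ B ∧ b ≠ 0})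
    (fun b hb => (MonomialOrder.leadingCoeff_ne_zero_iff.2 hb.2).isUnit) f
  have hg : Finsupp.linearCombination _ (fun b : {b | b ∈ B ∧ b ≠ 0} => b.1) g ∈ Ideal.span B := by
    rw [Finsupp.linearCombination_apply]
    exact Submodule.sum_mem _ fun b _ => Ideal.mul_mem_left _ _ (Ideal.subset_span b.2.1)
  have hr0 : r = 0 := by
    by_contra h0
    have hra : r ∈ a := by
      have := a.sub_mem hf (Ideal.span_le.2 hB.1 hg)
      rwa [hfr, add_sub_cancel_left] at this
    obtain ⟨b, hb, hb0, hle⟩ := (not_isStandard_iff hB).1 fun h : IsStandard m a _ =>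
      h r hra h0 rfl
    exact hr _ (m.degree_mem_support h0) b ⟨hb, hb0⟩ hle
  rwa [hfr, hr0, add_zero]

/-- The ideal is generated by homogeneous elements. The component of the normal form in the degree
of `u` is thus again congruent to `u` and supported on standard monomials, and uniqueness makes it
the whole normal form. -/
theorem degree_eq_of_mem_support_normalForm {B : Set (MvPolynomial (Fin n) k)}
    (hB : IsGroebnerBasis m B a) {d : ℕ} (hd : ∀ b ∈ B, b.IsHomogeneous d) {u v : Fin n →₀ ℕ}
    (hv : v ∈ (normalForm m a (MvPolynomial.monomial u (1 : k))).support) :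
    v.degree = u.degree := by
  let _ := MvPolynomial.gradedAlgebra (σ := Fin n) (R := k)
  have ha : a.IsHomogeneous (MvPolynomial.homogeneousSubmodule (Fin n) k) := by
    rw [← hB.span_eq]
    exact Ideal.homogeneous_span _ _ fun b hb => ⟨d, hd b hb⟩
  set r := normalForm m a (MvPolynomial.monomial u (1 : k)) with hr
  have h1 := MvPolynomial.homogeneousComponent_mem_of_mem ha
    (sub_normalForm_mem m a (MvPolynomial.monomial u (1 : k))) u.degree
  rw [map_sub, MvPolynomial.homogeneousComponent_eq_self
    (MvPolynomial.isHomogeneous_monomial _ rfl)] at h1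
  have h2 := eq_normalForm m a _ _ h1 fun w hw => by
    rw [MvPolynomial.support_homogeneousComponent, Finset.mem_filter] at hw
    exact IsStandard.of_mem_support hw.1
  rw [← hr] at h2
  rw [← h2, MvPolynomial.support_homogeneousComponent, Finset.mem_filter] at hv
  exact hv.2

/-- The combinatorial properties of the set of standard monomials of an ideal with a quadratic
Gröbner basis. -/
structure IsQuadratic (m : MonomialOrder (Fin n)) (a : Ideal (MvPolynomial (Fin n) k)) : Prop where
  standard_of_degree_le : ∀ v : Fin n →₀ ℕ, v.degree ≤ 1 → IsStandard m a v
  exists_of_add : ∀ v w : Fin n →₀ ℕ, IsStandard m a v → IsStandard m a w →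
    ¬ IsStandard m a (v + w) →
      ∃ i j, v i ≠ 0 ∧ w j ≠ 0 ∧ ¬ IsStandard m a (Finsupp.single i 1 + Finsupp.single j 1)
  degree_eq : ∀ u v : Fin n →₀ ℕ,
    v ∈ (normalForm m a (MvPolynomial.monomial u (1 : k))).support → v.degree = u.degree

theorem exists_eq_single_of_degree {u : Fin n →₀ ℕ} (h : u.degree = 1) :
    ∃ i, u = Finsupp.single i 1 := by
  have hu : u ≠ 0 := by
    rintro rfl
    simp at h
  obtain ⟨i, hi⟩ := Finsupp.ne_iff.1 hu
  have hle : Finsupp.single i 1 ≤ u := by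
    rw [Finsupp.single_le_iff]
    exact Nat.one_le_iff_ne_zero.2 hi
  have h2 : (u - Finsupp.single i 1).degree = 0 := by
    have h3 := congrArg Finsupp.degree (add_tsub_cancel_of_le hle)
    rw [map_add, Finsupp.degree_single] at h3
    omega
  rw [Finsupp.degree_eq_zero_iff] at h2
  refine ⟨i, ?_⟩
  rw [← add_tsub_cancel_of_le hle, h2, add_zero]

/-- If `v` and `w` are standard but their product is not, a leading monomial u of degree 2 divides
the product but neither factor. Its part `u ⊓ v` in `v` and its remaining part `u - v` in `w` are
then both nontrivial, so each is a single variable. -/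
theorem IsGroebnerBasis.isQuadratic {B : Set (MvPolynomial (Fin n) k)}
    (hB : IsGroebnerBasis m B a) (hquad : ∀ b ∈ B, b.IsHomogeneous 2) : IsQuadratic m a := by
  have hdeg : ∀ b ∈ B, b ≠ 0 → (m.degree b).degree = 2 := fun b hb hb0 => by
    by_contra h
    exact MvPolynomial.mem_support_iff.1 (m.degree_mem_support hb0) ((hquad b hb).coeff_eq_zero h)
  refine ⟨fun v hv => ?_, fun v w hv hw hvw => ?_, fun u v =>
    degree_eq_of_mem_support_normalForm hB hquad⟩
  · by_contra h
    obtain ⟨b, hb, hb0, hle⟩ := (not_isStandard_iff hB).1 h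
    have h1 := congrArg Finsupp.degree (add_tsub_cancel_of_le hle)
    rw [map_add, hdeg b hb hb0] at h1
    omega
  · obtain ⟨b, hb, hb0, hle⟩ := (not_isStandard_iff hB).1 hvw
    set u := m.degree b with hu
    have hsum : u ⊓ v + (u - v) = u := by
      ext i
      simp only [Finsupp.coe_add, Pi.add_apply, Finsupp.inf_apply, Finsupp.coe_tsub, Pi.sub_apply]
      omega
    have hle2 : u - v ≤ w := tsub_le_iff_left.2 hle
    have hstd : ∀ t, IsStandard m a t → ¬ u ≤ t := fun t ht hut =>
      ht.mono hut b (hB.1 hb) hb0 rfl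
    have h1 : (u ⊓ v).degree ≠ 0 := by
      intro h0
      rw [Finsupp.degree_eq_zero_iff] at h0
      rw [h0, zero_add] at hsum
      exact hstd w hw (hsum ▸ hle2)
    have h2 : (u - v).degree ≠ 0 := by
      intro h0
      rw [Finsupp.degree_eq_zero_iff] at h0
      exact hstd v hv (tsub_eq_zero_iff_le.1 h0)
    have h3 := congrArg Finsupp.degree hsum
    rw [map_add, hu, hdeg b hb hb0, ← hu] at h3
    obtain ⟨i, hi⟩ := exists_eq_single_of_degree (u := u ⊓ v) (by omega)
    obtain ⟨j, hj⟩ := exists_eq_single_of_degree (u := u - v) (by omega)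
    refine ⟨i, j, ?_, ?_, ?_⟩
    · have h4 : u ⊓ v ≤ v := inf_le_right
      rw [hi, Finsupp.single_le_iff] at h4
      omega
    · rw [hj, Finsupp.single_le_iff] at hle2
      omega
    · rw [← hi, ← hj, hsum]
      exact fun h => h b (hB.1 hb) hb0 rfl

end Groebner

/-! ### The bar differential: its nonzero coefficients and the contracting homotopy -/

section Bar

variable {m : MonomialOrder (Fin n)} {a : Ideal (MvPolynomial (Fin n) k)}

/-- The product of the entries of a cell (written as exponent). -/
noncomputable def Cell.total (c : Cell m a) : Fin n →₀ ℕ := (c.map Subtype.val).sum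

@[simp]
theorem Cell.total_nil : Cell.total ([] : Cell m a) = 0 := rfl

@[simp]
theorem Cell.total_cons (w : StdMon m a) (c : Cell m a) :
    Cell.total (w :: c) = w.1 + Cell.total c := rfl

theorem StdMon.degree_pos (w : StdMon m a) : 0 < w.1.degree :=
  Nat.pos_of_ne_zero fun h => w.2.1 ((Finsupp.degree_eq_zero_iff _).1 h)

theorem StdMon.ne_of_eq_add {u v w : StdMon m a} (h : w.1 = u.1 + v.1) : w ≠ u ∧ w ≠ v := by
  constructor
  · rintro rfl
    exact v.2.1 (by simpa using h)
  · rintro rfl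
    exact u.2.1 (by simpa using h)

theorem Cell.total_cons_ne (w : StdMon m a) (c : Cell m a) :
    Cell.total (w :: c) ≠ Cell.total c := fun h => w.2.1 (by simpa using h)

theorem Cell.length_le_degree_total (c : Cell m a) : c.length ≤ (Cell.total c).degree := by
  induction c with
  | nil => simp
  | cons w c ih =>
    have := w.degree_pos
    rw [Cell.total_cons, map_add, List.length_cons]
    omega

variable (m a) in
open Classical in
/-- The linear map `v ↦ [v|c]` on standard monomials `v ≠ 1`, which is `0` on all other
monomials. -/
noncomputable def consL (c : Cell m a) :
    MvPolynomial (Fin n) k →ₗ[k] (Cell m a →₀ QuotAlg a) :=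
  (MvPolynomial.basisMonomials (Fin n) k).constr k fun v =>
    if h : v ≠ 0 ∧ IsStandard m a v then Finsupp.single (⟨v, h⟩ :: c) 1 else 0

theorem consL_monomial (c : Cell m a) (v : StdMon m a) :
    consL m a c (MvPolynomial.monomial v.1 1) = Finsupp.single (v :: c) 1 := by
  have h := (MvPolynomial.basisMonomials (Fin n) k).constr_basis k (M' := Cell m a →₀ QuotAlg a)
  simp only [MvPolynomial.coe_basisMonomials] at h
  rw [consL, h, dif_pos v.2]

theorem consL_one (c : Cell m a) : consL m a c (MvPolynomial.monomial 0 1) = 0 := by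
  have h := (MvPolynomial.basisMonomials (Fin n) k).constr_basis k (M' := Cell m a →₀ QuotAlg a)
  simp only [MvPolynomial.coe_basisMonomials] at h
  rw [consL, h, dif_neg (by simp)]

open Classical in
theorem consL_apply (c : Cell m a) (r : MvPolynomial (Fin n) k) :
    consL m a c r = ∑ v ∈ r.support.subtype (fun v => v ≠ 0 ∧ IsStandard m a v),
      Finsupp.single (v :: c) (algebraMap k (QuotAlg a) (r.coeff v.1)) := by
  have h := (MvPolynomial.basisMonomials (Fin n) k).constr_basis k (M' := Cell m a →₀ QuotAlg a)
  simp only [MvPolynomial.coe_basisMonomials] at h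
  have h2 : consL m a c r = ∑ v ∈ r.support, r.coeff v •
      (if h : v ≠ 0 ∧ IsStandard m a v then
        Finsupp.single ((⟨v, h⟩ : StdMon m a) :: c) (1 : QuotAlg a) else 0) := by
    conv_lhs => rw [r.as_sum, map_sum]
    refine Finset.sum_congr rfl fun v _ => ?_
    rw [← mul_one (r.coeff v), ← smul_eq_mul, ← MvPolynomial.smul_monomial, map_smul, consL, h,
      smul_eq_mul, mul_one]
  rw [h2, ← Finset.sum_filter_of_ne (p := fun v => v ≠ 0 ∧ IsStandard m a v),
    ← Finset.sum_subtype_eq_sum_filter]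
  · refine Finset.sum_congr rfl fun v _ => ?_
    rw [dif_pos v.2, Finsupp.smul_single, Algebra.algebraMap_eq_smul_one]
  · intro v _ hv
    by_contra hp
    rw [dif_neg hp, smul_zero] at hv
    exact hv rfl

theorem mergeD_cons_cons (w w' : StdMon m a) (c : Cell m a) :
    mergeD m a (w :: w' :: c) =
      - consL m a c (normalForm m a (MvPolynomial.monomial (w.1 + w'.1) 1))
      - (mergeD m a (w' :: c)).mapDomain (fun c' => w :: c') := by
  rw [consL_apply, mergeD]

variable (m a) in
/-- The relation `[c : d] ≠ 0` for the inner part of the bar differential: two neighbours `u`, `v`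
in `c` are replaced by a monomial of the normal form of their product. -/
inductive Merges : Cell m a → Cell m a → Prop
  | head (u v w : StdMon m a) (q : Cell m a)
      (h : w.1 ∈ (normalForm m a (MvPolynomial.monomial (u.1 + v.1) (1 : k))).support) :
      Merges (u :: v :: q) (w :: q)
  | cons (u : StdMon m a) (c d : Cell m a) (h : Merges c d) : Merges (u :: c) (u :: d)

variable (m a) in
/-- Two neighbours in the first cell are replaced by their product. -/
inductive StdMerges : Cell m a → Cell m a → Prop
  | head (u v w : StdMon m a) (q : Cell m a) (h : w.1 = u.1 + v.1) :
      StdMerges (u :: v :: q) (w :: q)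
  | cons (u : StdMon m a) (c d : Cell m a) (h : StdMerges c d) : StdMerges (u :: c) (u :: d)

theorem consL_apply_ne_zero {c d : Cell m a} {r : MvPolynomial (Fin n) k}
    (h : consL m a c r d ≠ 0) : ∃ v : StdMon m a, v.1 ∈ r.support ∧ d = v :: c := by
  classical
  rw [consL_apply, Finset.sum_apply'] at h
  obtain ⟨v, hv, hvd⟩ := Finset.exists_ne_zero_of_sum_ne_zero h
  refine ⟨v, by simpa using hv, ?_⟩
  by_contra hne
  exact hvd (Finsupp.single_eq_of_ne hne)

theorem Merges.of_mergeD_ne_zero :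
    ∀ {c d : Cell m a}, mergeD m a c d ≠ 0 → Merges m a c d
  | [], d, h => by simp [mergeD] at h
  | [w], d, h => by simp [mergeD] at h
  | w :: w' :: c, d, h => by
    rw [mergeD_cons_cons, Finsupp.sub_apply, Finsupp.neg_apply] at h
    by_cases h1 : consL m a c (normalForm m a (MvPolynomial.monomial (w.1 + w'.1) 1)) d = 0
    · rw [h1, neg_zero, zero_sub, neg_ne_zero] at h
      by_cases h2 : d ∈ Set.range (List.cons w)
      · obtain ⟨d, rfl⟩ := h2
        rw [Finsupp.mapDomain_apply List.cons_injective] at h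
        exact .cons _ _ _ (of_mergeD_ne_zero h)
      · exact (h (Finsupp.mapDomain_of_notMem_range _ _ h2)).elim
    · obtain ⟨v, hv, rfl⟩ := consL_apply_ne_zero h1
      exact .head _ _ _ _ hv

theorem Merges.of_barD_ne_zero {c d : Cell m a} (h : barD m a c d ≠ 0) :
    (∃ w, c = w :: d) ∨ Merges m a c d := by
  match c, h with
  | [], h => simp [barD] at h
  | w :: c, h =>
    rw [barD, Finsupp.add_apply] at h
    by_cases h1 : c = d
    · exact .inl ⟨w, by rw [h1]⟩
    · rw [Finsupp.single_eq_of_ne (Ne.symm h1), zero_add] at h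
      exact .inr (of_mergeD_ne_zero h)

theorem Merges.length_eq {c d : Cell m a} (h : Merges m a c d) : c.length = d.length + 1 := by
  induction h <;> simp_all

theorem Merges.degree_total (hq : IsQuadratic m a) {c d : Cell m a} (h : Merges m a c d) :
    (Cell.total d).degree = (Cell.total c).degree := by
  induction h with
  | head u v w q h =>
    have := hq.degree_eq _ _ h
    simp only [Cell.total_cons, map_add] at this ⊢
    omega
  | cons u c d h ih =>
    simp [ih]

/-- The first component of the termination measure can stay constant along an inner edge only when
two neighbours are replaced by their actual product. -/
theorem Merges.lt_or_stdMerges {c d : Cell m a} (h : Merges m a c d) :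
    Cell.total d ≺[m] Cell.total c ∨ StdMerges m a c d := by
  induction h with
  | head u v w q h =>
    rcases eq_or_lt_of_mem_support_normalForm h with h | h
    · exact .inr (.head _ _ _ _ h)
    · left
      rw [Cell.total_cons, Cell.total_cons, Cell.total_cons, ← add_assoc, map_add,
        map_add _ (u.1 + v.1)]
      exact add_lt_add_left h _
  | cons u c d h ih =>
    rcases ih with ih | ih
    · left
      rw [Cell.total_cons, Cell.total_cons, map_add, map_add]
      exact add_lt_add_right ih _
    · exact .inr (.cons _ _ _ ih)

theorem StdMerges.total_eq {c d : Cell m a} (h : StdMerges m a c d) :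
    Cell.total d = Cell.total c := by
  induction h with
  | head u v w q h => simp [h, add_assoc]
  | cons u c d h ih => simp [ih]

theorem StdMerges.length_eq {c d : Cell m a} (h : StdMerges m a c d) :
    c.length = d.length + 1 := by
  induction h <;> simp_all

theorem length_eq_of_barD_ne_zero (c d : Cell m a) (h : barD m a c d ≠ 0) :
    c.length = d.length + 1 := by
  rcases Merges.of_barD_ne_zero h with ⟨w, rfl⟩ | h
  · simp
  · exact h.length_eq

/-- The merge contributes a sign, and nothing can cancel it: another term yielding the same cell
would force a factor of the product to be trivial, as a comparison of first entries or of total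
products shows. -/
theorem StdMerges.isUnit_mergeD {c d : Cell m a} (h : StdMerges m a c d) :
    IsUnit (mergeD m a c d) := by
  induction h with
  | head u v w q h =>
    have h1 : (w :: q) ∉ Set.range (List.cons u) := by
      rintro ⟨q', hq'⟩
      exact (StdMon.ne_of_eq_add h).1 (List.cons.inj hq').1.symm
    rw [mergeD_cons_cons, Finsupp.sub_apply, Finsupp.neg_apply, ← h, normalForm_monomial w.2.2,
      consL_monomial, Finsupp.mapDomain_of_notMem_range _ _ h1]
    rw [Finsupp.single_eq_same, sub_zero]
    exact (isUnit_one (M := QuotAlg a)).neg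
  | cons u c d h ih =>
    have htot := h.total_eq
    match c, h, ih with
    | t :: c, h, ih =>
      have h1 : consL m a c (normalForm m a (MvPolynomial.monomial (u.1 + t.1) 1)) (u :: d) = 0 := by
        by_contra h1
        obtain ⟨v, -, hv⟩ := consL_apply_ne_zero h1
        rw [(List.cons.inj hv).2] at htot
        exact Cell.total_cons_ne t c htot.symm
      rw [mergeD_cons_cons, Finsupp.sub_apply, Finsupp.neg_apply, h1,
        Finsupp.mapDomain_apply List.cons_injective, neg_zero, zero_sub]
      exact ih.neg

theorem StdMerges.isUnit_barD {c d : Cell m a} (h : StdMerges m a c d) :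
    IsUnit (barD m a c d) := by
  match c, h with
  | w :: c, h =>
    have hne : d ≠ c := by
      rintro rfl
      exact Cell.total_cons_ne w d h.total_eq.symm
    rw [barD, Finsupp.add_apply, Finsupp.single_eq_of_ne hne, zero_add]
    exact h.isUnit_mergeD

theorem mk_monomial_mem_maxIdeal {v : Fin n →₀ ℕ} (hv : v ≠ 0) :
    Ideal.Quotient.mk a (MvPolynomial.monomial v 1) ∈ maxIdeal a := by
  obtain ⟨i, hi⟩ := Finsupp.ne_iff.1 hv
  have hle : Finsupp.single i 1 ≤ v := by
    rw [Finsupp.single_le_iff]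
    exact Nat.one_le_iff_ne_zero.2 hi
  rw [← add_tsub_cancel_of_le hle, ← one_mul (1 : k), ← MvPolynomial.monomial_mul, map_mul]
  exact Ideal.mul_mem_right _ _ (Ideal.subset_span ⟨i, rfl⟩)

/-- Inner edges preserve the degree of the product of the entries. So only the outer term can lower
it, and its coefficient is the removed entry. -/
theorem barD_mem_maxIdeal (hq : IsQuadratic m a) {c d : Cell m a}
    (h : (Cell.total d).degree < (Cell.total c).degree) : barD m a c d ∈ maxIdeal a := by
  match c, h with
  | w :: c, h =>
    have h1 : mergeD m a (w :: c) d = 0 := by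
      by_contra h1
      exact h.ne ((Merges.of_mergeD_ne_zero h1).degree_total hq)
    rw [barD, Finsupp.add_apply, h1, add_zero]
    by_cases hd : d = c
    · rw [hd, Finsupp.single_eq_same]
      exact mk_monomial_mem_maxIdeal w.2.1
    · rw [Finsupp.single_eq_of_ne hd]
      exact Ideal.zero_mem _

variable (m a) in
/-- The normal form of the elements of `A`. -/
noncomputable def quotNormalForm : QuotAlg a →ₗ[k] MvPolynomial (Fin n) k where
  toFun x := normalForm m a (Quotient.out x)
  map_add' x y := by
    refine (eq_normalForm m a _ _ ?_ fun v hv => ?_).symm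
    · have hx := sub_normalForm_mem m a (Quotient.out x)
      have hy := sub_normalForm_mem m a (Quotient.out y)
      rw [← Ideal.Quotient.eq] at hx hy ⊢
      rw [map_add, ← hx, ← hy, Ideal.Quotient.mk_out, Ideal.Quotient.mk_out,
        Ideal.Quotient.mk_out]
    · classical
      rcases Finset.mem_union.1 (MvPolynomial.support_add hv) with h | h
      · exact IsStandard.of_mem_support h
      · exact IsStandard.of_mem_support h
  map_smul' b x := by
    refine (eq_normalForm m a _ _ ?_ fun v hv => ?_).symm
    · have hx := sub_normalForm_mem m a (Quotient.out x)
      rw [← Ideal.Quotient.eq] at hx ⊢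
      rw [RingHom.id_apply, MvPolynomial.smul_eq_C_mul, map_mul, ← hx, Ideal.Quotient.mk_out,
        Ideal.Quotient.mk_out]
      exact Algebra.smul_def b x
    · exact IsStandard.of_mem_support (MvPolynomial.support_smul hv)

theorem quotNormalForm_mk (f : MvPolynomial (Fin n) k) :
    quotNormalForm m a (Ideal.Quotient.mk a f) = normalForm m a f := by
  refine eq_normalForm m a _ _ ?_ fun v => IsStandard.of_mem_support
  have h := sub_normalForm_mem m a (Quotient.out (Ideal.Quotient.mk a f))
  rw [← Ideal.Quotient.eq, Ideal.Quotient.mk_out] at h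
  rw [← Ideal.Quotient.eq]
  exact h

variable (m a) in
/-- The standard monomials span `A`. -/
theorem span_standard_eq_top :
    Submodule.span k ((fun v => Ideal.Quotient.mk a (MvPolynomial.monomial v 1)) ''
      {v | IsStandard m a v}) = ⊤ := by
  refine eq_top_iff.2 fun x _ => ?_
  obtain ⟨f, rfl⟩ := Ideal.Quotient.mk_surjective x
  rw [Ideal.Quotient.eq.2 (sub_normalForm_mem m a f), (normalForm m a f).as_sum, map_sum]
  refine Submodule.sum_mem _ fun v hv => ?_
  rw [← mul_one (MvPolynomial.coeff v _), ← smul_eq_mul, ← MvPolynomial.smul_monomial,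
    ← Ideal.Quotient.mkₐ_eq_mk k, map_smul]
  exact Submodule.smul_mem _ _ (Submodule.subset_span ⟨v, IsStandard.of_mem_support hv, rfl⟩)

variable (m a) in
/-- The coefficient of `1` in the normal form. -/
noncomputable def constCoeff : QuotAlg a →ₗ[k] k :=
  MvPolynomial.lcoeff k 0 ∘ₗ quotNormalForm m a

theorem constCoeff_monomial (hq : IsQuadratic m a) {v : Fin n →₀ ℕ} (hv : v ≠ 0) :
    constCoeff m a (Ideal.Quotient.mk a (MvPolynomial.monomial v 1)) = 0 := by
  change MvPolynomial.coeff 0 (quotNormalForm m a _) = 0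
  rw [quotNormalForm_mk]
  by_contra h
  have := hq.degree_eq v 0 (MvPolynomial.mem_support_iff.2 h)
  rw [map_zero, eq_comm, Finsupp.degree_eq_zero_iff] at this
  exact hv this

/-- A variable times a standard monomial has positive degree, and so has every term of its normal
form. -/
theorem constCoeff_eq_zero (hq : IsQuadratic m a) {x : QuotAlg a} (hx : x ∈ maxIdeal a) :
    constCoeff m a x = 0 := by
  suffices h : ∀ y, constCoeff m a (y * x) = 0 by simpa using h 1
  refine Submodule.span_induction (p := fun x _ => ∀ y, constCoeff m a (y * x) = 0)
    ?_ (by simp) (fun x y _ _ hx hy z => ?_) (fun b x _ h y => ?_) hx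
  · rintro _ ⟨i, rfl⟩ y
    have hy : y ∈ Submodule.span k ((fun v => Ideal.Quotient.mk a (MvPolynomial.monomial v 1)) ''
      {v | IsStandard m a v}) := by
      rw [span_standard_eq_top]
      trivial
    refine Submodule.span_induction ?_ (by simp) (fun x y _ _ hx hy => ?_)
      (fun b x _ h => ?_) hy
    · rintro _ ⟨v, -, rfl⟩
      rw [← map_mul, MvPolynomial.X, MvPolynomial.monomial_mul, one_mul]
      exact constCoeff_monomial hq (by simp)
    · rw [add_mul, map_add, hx, hy, add_zero]
    · rw [smul_mul_assoc, map_smul, h, smul_zero]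
  · rw [mul_add, map_add, hx, hy, add_zero]
  · rw [smul_eq_mul, ← mul_assoc]
    exact h _

variable (m a) in
/-- The span over `k` of the cells. -/
noncomputable def cellSpan : Submodule k (Cell m a →₀ QuotAlg a) :=
  Submodule.span k (Set.range fun c => Finsupp.single c 1)

theorem consL_mem_cellSpan (c : Cell m a) (r : MvPolynomial (Fin n) k) :
    consL m a c r ∈ cellSpan m a := by
  rw [consL_apply]
  refine Submodule.sum_mem _ fun v _ => ?_
  rw [Algebra.algebraMap_eq_smul_one, ← Finsupp.smul_single]
  exact Submodule.smul_mem _ _ (Submodule.subset_span ⟨_, rfl⟩)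

theorem mergeD_mem_cellSpan : ∀ c : Cell m a, mergeD m a c ∈ cellSpan m a
  | [] => by simp [mergeD]
  | [w] => by simp [mergeD]
  | w :: w' :: c => by
    rw [mergeD_cons_cons]
    refine sub_mem (neg_mem (consL_mem_cellSpan _ _)) ?_
    have h : cellSpan m a ≤ (cellSpan m a).comap
        (Finsupp.lmapDomain (QuotAlg a) k (List.cons w)) := by
      rw [cellSpan, Submodule.span_le]
      rintro _ ⟨c, rfl⟩
      rw [SetLike.mem_coe, Submodule.mem_comap, Finsupp.lmapDomain_apply,
        Finsupp.mapDomain_single]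
      exact Submodule.subset_span ⟨_, rfl⟩
    exact h (mergeD_mem_cellSpan (w' :: c))

variable (m a) in
/-- The contracting homotopy of the bar resolution. -/
noncomputable def homotopy : (Cell m a →₀ QuotAlg a) →ₗ[k] (Cell m a →₀ QuotAlg a) :=
  Finsupp.lsum k fun c => consL m a c ∘ₗ quotNormalForm m a

theorem homotopy_single (c : Cell m a) (x : QuotAlg a) :
    homotopy m a (Finsupp.single c x) = consL m a c (quotNormalForm m a x) := by
  simp [homotopy]

theorem homotopy_single_monomial (c : Cell m a) (v : StdMon m a) :
    homotopy m a (Finsupp.single c (Ideal.Quotient.mk a (MvPolynomial.monomial v.1 1))) =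
      Finsupp.single (v :: c) 1 := by
  rw [homotopy_single, quotNormalForm_mk, normalForm_monomial v.2.2, consL_monomial]

theorem homotopy_single_one (hq : IsQuadratic m a) (c : Cell m a) :
    homotopy m a (Finsupp.single c 1) = 0 := by
  rw [homotopy_single, ← map_one (Ideal.Quotient.mk a), quotNormalForm_mk,
    ← MvPolynomial.C_1, MvPolynomial.C_apply, normalForm_monomial, consL_one]
  exact hq.standard_of_degree_le 0 (by simp)

/-- A cell with coefficient 1 would be sent to a cell with entry 1, which is zero in the normalized
resolution. The lemma is applied to the inner part of the differential, whose coefficients are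
scalars. -/
theorem homotopy_eq_zero (hq : IsQuadratic m a) {x : Cell m a →₀ QuotAlg a}
    (hx : x ∈ cellSpan m a) : homotopy m a x = 0 := by
  have h : cellSpan m a ≤ LinearMap.ker (homotopy m a) := by
    rw [cellSpan, Submodule.span_le]
    rintro _ ⟨c, rfl⟩
    exact homotopy_single_one hq c
  exact h hx

theorem homotopy_smul (v : StdMon m a) {x : Cell m a →₀ QuotAlg a} (hx : x ∈ cellSpan m a) :
    homotopy m a (Ideal.Quotient.mk a (MvPolynomial.monomial v.1 1) • x) =
      x.mapDomain (List.cons v) := by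
  refine Submodule.span_induction ?_ (by simp) (fun x y _ _ hx hy => ?_) (fun b x _ h => ?_) hx
  · rintro _ ⟨c, rfl⟩
    dsimp only
    rw [Finsupp.smul_single, smul_eq_mul, mul_one, homotopy_single_monomial,
      Finsupp.mapDomain_single]
  · rw [smul_add, map_add, hx, hy, Finsupp.mapDomain_add]
  · rw [smul_comm, map_smul, h, Finsupp.mapDomain_smul]

end Bar

/-! ### Exactness of the bar resolution -/

section BarExact

open AlgMorse

variable {m : MonomialOrder (Fin n)} {a : Ideal (MvPolynomial (Fin n) k)}

theorem homotopy_identity_nil (hq : IsQuadratic m a) (x : QuotAlg a) :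
    totalD (barD m a) (homotopy m a (Finsupp.single [] x)) =
      Finsupp.single [] x - Finsupp.single [] (algebraMap k _ (constCoeff m a x)) := by
  have hx : x ∈ Submodule.span k ((fun v => Ideal.Quotient.mk a (MvPolynomial.monomial v 1)) ''
      {v | IsStandard m a v}) := by
    rw [span_standard_eq_top]
    trivial
  refine Submodule.span_induction ?_ (by simp) (fun x y _ _ hx hy => ?_) (fun b x _ h => ?_) hx
  · rintro _ ⟨v, hv, rfl⟩
    dsimp only
    by_cases h0 : v = 0
    · subst h0
      have h1 : constCoeff m a 1 = 1 := by
        change MvPolynomial.coeff 0 (quotNormalForm m a 1) = 1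
        rw [← map_one (Ideal.Quotient.mk a), quotNormalForm_mk, ← MvPolynomial.C_1,
          MvPolynomial.C_apply, normalForm_monomial hv]
        simp
      rw [← MvPolynomial.C_apply, MvPolynomial.C_1, map_one, homotopy_single_one hq, h1]
      simp
    · rw [homotopy_single_monomial [] ⟨v, h0, hv⟩, constCoeff_monomial hq h0]
      simp [barD, mergeD]
  · rw [Finsupp.single_add, map_add, map_add, hx, hy, map_add, map_add, Finsupp.single_add]
    abel
  · rw [← Finsupp.smul_single, map_smul, LinearMap.map_smul_of_tower, h, map_smul, smul_sub,
      Finsupp.smul_single, Finsupp.smul_single, Algebra.algebraMap_eq_smul_one,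
      Algebra.algebraMap_eq_smul_one, smul_eq_mul, mul_smul]

/-- It suffices to take `x` a standard monomial v. For v ≠ 1 the terms of ∂[v|w|c] other than v[w|c]
are those merging v with w and those merging inside [w|c]. They cancel against the images under the
homotopy of v times the outer and the inner part of ∂[w|c]. For v = 1 only the outer part survives
and returns the cell itself. -/
theorem homotopy_identity_cons (hq : IsQuadratic m a) (w : StdMon m a) (c : Cell m a)
    (x : QuotAlg a) :
    totalD (barD m a) (homotopy m a (Finsupp.single (w :: c) x)) +
      homotopy m a (totalD (barD m a) (Finsupp.single (w :: c) x)) =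
        Finsupp.single (w :: c) x := by
  have hx : x ∈ Submodule.span k ((fun v => Ideal.Quotient.mk a (MvPolynomial.monomial v 1)) ''
      {v | IsStandard m a v}) := by
    rw [span_standard_eq_top]
    trivial
  refine Submodule.span_induction ?_ (by simp) (fun x y _ _ hx hy => ?_) (fun b x _ h => ?_) hx
  · rintro _ ⟨v, hv, rfl⟩
    dsimp only
    by_cases h0 : v = 0
    · subst h0
      rw [← MvPolynomial.C_apply, MvPolynomial.C_1, map_one, homotopy_single_one hq, totalD_single,
        map_zero, zero_add, one_smul, barD, map_add, homotopy_single_monomial,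
        homotopy_eq_zero hq (mergeD_mem_cellSpan _), add_zero]
    · rw [homotopy_single_monomial _ ⟨v, h0, hv⟩, totalD_single, totalD_single, barD, barD,
        one_smul, mergeD_cons_cons, smul_add, map_add,
        homotopy_smul ⟨v, h0, hv⟩ (mergeD_mem_cellSpan _), Finsupp.smul_single, smul_eq_mul,
        ← map_mul, MvPolynomial.monomial_mul, one_mul, homotopy_single, quotNormalForm_mk]
      abel
  · rw [Finsupp.single_add, map_add, map_add, map_add, map_add, add_add_add_comm, hx, hy]
  · rw [← Finsupp.smul_single, map_smul, LinearMap.map_smul_of_tower, LinearMap.map_smul_of_tower,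
      map_smul, ← smul_add, h]

/-- The homotopy is a contraction of the augmented bar resolution. -/
theorem homotopy_identity (hq : IsQuadratic m a) (x : Cell m a →₀ QuotAlg a) :
    totalD (barD m a) (homotopy m a x) + homotopy m a (totalD (barD m a) x) =
      x - Finsupp.single [] (algebraMap k _ (constCoeff m a (x []))) := by
  induction x using Finsupp.induction_linear with
  | zero => simp
  | add x y hx hy =>
    rw [map_add, map_add, map_add, map_add, add_add_add_comm, hx, hy, Finsupp.add_apply, map_add,
      map_add, Finsupp.single_add]
    abel
  | single c x =>
    match c with
    | [] =>
      rw [homotopy_identity_nil hq, totalD_single, barD, smul_zero, map_zero, add_zero,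
        Finsupp.single_eq_same]
    | w :: c =>
      rw [homotopy_identity_cons hq, Finsupp.single_eq_of_ne (by simp), map_zero, map_zero,
        Finsupp.single_zero, sub_zero]

theorem barD_nil_mem_maxIdeal (hq : IsQuadratic m a) (c : Cell m a) :
    barD m a c [] ∈ maxIdeal a := by
  match c with
  | [] => simp [barD]
  | w :: c =>
    refine barD_mem_maxIdeal hq ?_
    have := w.degree_pos
    simp only [Cell.total_cons, Cell.total_nil, map_add, map_zero]
    omega

/-- Associativity of the normal form product need not be unwound. With h the homotopy, [w|c] = h(y)
for y = w[c]. Up to a multiple of [], which ∂ kills, ∂h(y) = y - h∂(y), so ∂∂h(y) = ∂y - ∂h(∂y). By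
induction ∂∂y = 0, so the homotopy identity for ∂y gives ∂h(∂y) = ∂y. -/
theorem totalD_totalD (hq : IsQuadratic m a) (x : Cell m a →₀ QuotAlg a) :
    totalD (barD m a) (totalD (barD m a) x) = 0 := by
  have key : ∀ (c : Cell m a) (b : QuotAlg a),
      totalD (barD m a) (totalD (barD m a) (Finsupp.single c b)) = 0 := by
    intro c
    induction c with
    | nil => simp [barD]
    | cons w c ih =>
      intro b
      have h0 : ∀ b' : k, totalD (barD m a) (Finsupp.single [] (algebraMap k _ b')) = 0 := by
        simp [barD]
      set y := Finsupp.single c (Ideal.Quotient.mk a (MvPolynomial.monomial w.1 1)) with hy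
      have h1 : homotopy m a y = Finsupp.single (w :: c) 1 := homotopy_single_monomial c w
      have h2 : totalD (barD m a) y [] ∈ maxIdeal a := by
        rw [hy, totalD_single, Finsupp.smul_apply]
        exact Ideal.mul_mem_left _ _ (barD_nil_mem_maxIdeal hq c)
      have h3 := homotopy_identity hq y
      have h4 := homotopy_identity hq (totalD (barD m a) y)
      rw [constCoeff_eq_zero hq h2, map_zero, Finsupp.single_zero, sub_zero, ih, map_zero,
        add_zero] at h4
      have h5 := congrArg (totalD (barD m a)) h3
      rw [map_add, map_sub, h4, h0, sub_zero, add_eq_right, h1] at h5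
      rw [← mul_one b, ← smul_eq_mul, ← Finsupp.smul_single, map_smul, map_smul, h5, smul_zero]
  induction x using Finsupp.induction_linear with
  | zero => simp
  | add x y hx hy => simp [hx, hy]
  | single c b => exact key c b

theorem homotopy_mem {i : ℕ} {x : Cell m a →₀ QuotAlg a}
    (hx : x ∈ degPart (QuotAlg a) List.length i) :
    homotopy m a x ∈ degPart (QuotAlg a) List.length (i + 1) := by
  refine supported_induction
    (p := fun x => homotopy m a x ∈ degPart (QuotAlg a) List.length (i + 1)) ?_ ?_ ?_ hx
  · simp
  · intro x y hx hy
    simpa using add_mem hx hy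
  · rintro c hc b d hd
    rw [homotopy_single] at hd
    obtain ⟨v, -, rfl⟩ := consL_apply_ne_zero (Finsupp.mem_support_iff.1 hd)
    simpa using hc

theorem bar_exact (hq : IsQuadratic m a) {i : ℕ} {x : Cell m a →₀ QuotAlg a}
    (hx : x ∈ degPart (QuotAlg a) List.length (i + 1)) (h0 : totalD (barD m a) x = 0) :
    ∃ y ∈ degPart (QuotAlg a) List.length (i + 2), totalD (barD m a) y = x := by
  refine ⟨homotopy m a x, homotopy_mem hx, ?_⟩
  have hnil : x [] = 0 := by
    by_contra h
    have := hx (Finsupp.mem_support_iff.2 h)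
    simp at this
  have h := homotopy_identity hq x
  rwa [h0, map_zero, add_zero, hnil, map_zero, map_zero, Finsupp.single_zero, sub_zero] at h

theorem bar_exact_zero (hq : IsQuadratic m a) {x : QuotAlg a} (hx : x ∈ maxIdeal a) :
    ∃ y ∈ degPart (QuotAlg a) List.length 1,
      totalD (barD m a) y = Finsupp.single ([] : Cell m a) x := by
  refine ⟨homotopy m a (Finsupp.single [] x),
    homotopy_mem (Finsupp.single_mem_supported _ _ rfl), ?_⟩
  rw [homotopy_identity_nil hq, constCoeff_eq_zero hq hx, map_zero, Finsupp.single_zero, sub_zero]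

end BarExact

/-! ### The matching as a scan by letters -/

section Combinatorics

variable {m : MonomialOrder (Fin n)} {a : Ideal (MvPolynomial (Fin n) k)}

theorem exists_isLeast_fin {s : Set (Fin n)} (hs : s.Nonempty) : ∃ i, IsLeast s i :=
  ⟨_, WellFounded.min_mem wellFounded_lt s hs, fun _ hx => WellFounded.min_le wellFounded_lt hx⟩

variable (m a) in
/-- The letters that may follow the letter `i`, if `i` has been chosen from the set `L`. -/
def nextLetters (L : Set (Fin n)) (i : Fin n) : Set (Fin n) :=
  {l | ¬ IsStandard m a (Finsupp.single i 1 + Finsupp.single l 1) ∨ l < i ∧ l ∈ L}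

/-- The letters in `L` that divide `w`. -/
def lettersIn (L : Set (Fin n)) (w : Fin n →₀ ℕ) : Set (Fin n) := {j | j ∈ L ∧ w j ≠ 0}

variable (m a) in
/-- The matching in terms of the letters: the state `L` is the set of letters that are allowed in
the current position. -/
inductive LetterMatching : Set (Fin n) → Cell m a → Cell m a → Prop
  | head (L : Set (Fin n)) (u v w : StdMon m a) (q : Cell m a) (i : Fin n)
      (hi : IsLeast (lettersIn L w.1) i) (hu : u.1 = Finsupp.single i 1) (hw : w.1 = u.1 + v.1) :
      LetterMatching L (u :: v :: q) (w :: q)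
  | cons (L : Set (Fin n)) (u : StdMon m a) (c d : Cell m a) (i : Fin n) (hi : i ∈ L)
      (hu : u.1 = Finsupp.single i 1) (h : LetterMatching (nextLetters m a L i) c d) :
      LetterMatching L (u :: c) (u :: d)

theorem StdMon.add_ne_single (u v : StdMon m a) (i : Fin n) : u.1 + v.1 ≠ Finsupp.single i 1 := by
  intro h
  have h := congrArg Finsupp.degree h
  have hu := u.degree_pos
  have hv := v.degree_pos
  rw [map_add, Finsupp.degree_single] at h
  omega

theorem eq_of_single_eq {i j : Fin n} {u : Fin n →₀ ℕ} (hi : u = Finsupp.single i 1)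
    (hj : u = Finsupp.single j 1) : j = i :=
  (Finsupp.single_left_injective one_ne_zero (hi.symm.trans hj)).symm

/-- For a letter l of `v` the product x_i x_l divides the standard monomial `w`, so it is standard;
and l < i with l in `L` would contradict the minimality of i. Thus a split-off entry is recognized
by having no admissible letter. -/
theorem lettersIn_eq_empty {L : Set (Fin n)} {u v w : StdMon m a} {i : Fin n}
    (hi : IsLeast (lettersIn L w.1) i) (hu : u.1 = Finsupp.single i 1) (hw : w.1 = u.1 + v.1) :
    lettersIn (nextLetters m a L i) v.1 = ∅ := by
  refine Set.eq_empty_of_forall_notMem ?_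
  rintro l ⟨hl | ⟨hl, hlL⟩, hvl⟩
  · refine hl (w.2.2.mono ?_)
    rw [hw, hu]
    gcongr
    rw [Finsupp.single_le_iff]
    exact Nat.one_le_iff_ne_zero.2 hvl
  · have hmem : l ∈ lettersIn L w.1 := ⟨hlL, by simp [hw, hvl]⟩
    exact absurd (hi.2 hmem) (not_le.2 hl)

theorem LetterMatching.valid_source {L : Set (Fin n)} {w : StdMon m a} {c d : Cell m a}
    (h : LetterMatching m a L (w :: c) d) : (lettersIn L w.1).Nonempty := by
  cases h with
  | head _ _ v w q i hi hu hw => exact ⟨i, hi.1.1, by simp [hu]⟩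
  | cons _ _ c d i hi hu h => exact ⟨i, hi, by simp [hu]⟩

theorem LetterMatching.valid_target {L : Set (Fin n)} {w : StdMon m a} {c d : Cell m a}
    (h : LetterMatching m a L c (w :: d)) : (lettersIn L w.1).Nonempty := by
  cases h with
  | head _ u v _ _ i hi hu hw => exact ⟨i, hi.1⟩
  | cons _ _ c _ i hi hu h => exact ⟨i, hi, by simp [hu]⟩

theorem LetterMatching.stdMerges {L : Set (Fin n)} {c d : Cell m a}
    (h : LetterMatching m a L c d) : StdMerges m a c d := by
  induction h with
  | head L u v w q i hi hu hw => exact .head _ _ _ _ hw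
  | cons L u c d i hi hu h ih => exact .cons _ _ _ ih

/-- An edge acting here excludes an edge acting further right, since the latter needs an admissible
letter in the entry `v`. With `StdMon.add_ne_single` this yields the matching property. -/
theorem LetterMatching.not_cons_of_head {L : Set (Fin n)} {u v w : StdMon m a} {i : Fin n}
    {q d : Cell m a} (hi : IsLeast (lettersIn L w.1) i) (hu : u.1 = Finsupp.single i 1)
    (hw : w.1 = u.1 + v.1) : ¬ LetterMatching m a (nextLetters m a L i) (v :: q) d := by
  intro h
  have := h.valid_source
  rw [lettersIn_eq_empty hi hu hw] at this
  exact Set.not_nonempty_empty this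

theorem LetterMatching.target_unique {L : Set (Fin n)} {c d d' : Cell m a}
    (h : LetterMatching m a L c d) (h' : LetterMatching m a L c d') : d' = d := by
  induction h generalizing d' with
  | head L u v w q i hi hu hw =>
    cases h' with
    | head _ _ _ w' _ j hj hu' hw' => rw [Subtype.ext (hw'.trans hw.symm)]
    | cons _ _ _ d j hj hu' h' =>
      obtain rfl := eq_of_single_eq hu hu'
      exact (not_cons_of_head hi hu hw h').elim
  | cons L u c d i hi hu h ih =>
    cases h' with
    | head _ _ v w q j hj hu' hw' =>
      obtain rfl := eq_of_single_eq hu hu'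
      exact (not_cons_of_head hj hu' hw' h).elim
    | cons _ _ _ d j hj hu' h' =>
      obtain rfl := eq_of_single_eq hu hu'
      rw [ih h']

theorem LetterMatching.source_unique {L : Set (Fin n)} {c c' d : Cell m a}
    (h : LetterMatching m a L c d) (h' : LetterMatching m a L c' d) : c' = c := by
  induction h generalizing c' with
  | head L u v w q i hi hu hw =>
    cases h' with
    | head _ u' v' _ _ j hj hu' hw' =>
      obtain rfl := hi.unique hj
      obtain rfl : u' = u := Subtype.ext (hu'.trans hu.symm)
      rw [hw] at hw'
      rw [Subtype.ext (add_left_cancel hw').symm]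
    | cons _ _ _ d j hj hu' h' =>
      rw [hw] at hu'
      exact (StdMon.add_ne_single _ _ _ hu').elim
  | cons L u c d i hi hu h ih =>
    cases h' with
    | head _ u' v w q j hj hu' hw' =>
      rw [hw'] at hu
      exact (StdMon.add_ne_single _ _ _ hu).elim
    | cons _ _ _ d j hj hu' h' =>
      obtain rfl := eq_of_single_eq hu hu'
      rw [ih h']

/-- The scan passes only over single variables, so an entry just merged stops it. Conversely, the
first entry of a target contains an admissible letter, which the second factor of a split never
does. -/
theorem LetterMatching.not_source_of_target {L : Set (Fin n)} {c d e : Cell m a}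
    (h : LetterMatching m a L c d) (h' : LetterMatching m a L d e) : False := by
  induction h generalizing e with
  | head L u v w q i hi hu hw =>
    cases h' with
    | head _ _ v' w' _ j hj hu' hw' =>
      rw [hw] at hu'
      exact StdMon.add_ne_single _ _ _ hu'
    | cons _ _ _ d j hj hu' h' =>
      rw [hw] at hu'
      exact StdMon.add_ne_single _ _ _ hu'
  | cons L u c d i hi hu h ih =>
    cases h' with
    | head _ _ v w q j hj hu' hw' =>
      obtain rfl := eq_of_single_eq hu hu'
      have := h.valid_target
      rw [lettersIn_eq_empty hj hu' hw'] at this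
      exact Set.not_nonempty_empty this
    | cons _ _ _ d j hj hu' h' =>
      obtain rfl := eq_of_single_eq hu hu'
      exact ih h'

/-- Splitting off a variable from a standard monomial. -/
theorem StdMon.exists_eq_add (w : StdMon m a) {i : Fin n} (hi : w.1 i ≠ 0)
    (hne : w.1 ≠ Finsupp.single i 1) :
    ∃ u v : StdMon m a, u.1 = Finsupp.single i 1 ∧ w.1 = u.1 + v.1 := by
  have hle : Finsupp.single i 1 ≤ w.1 := by
    rw [Finsupp.single_le_iff]
    exact Nat.one_le_iff_ne_zero.2 hi
  refine ⟨⟨Finsupp.single i 1, by simp, w.2.2.mono hle⟩,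
    ⟨w.1 - Finsupp.single i 1, fun h => ?_, w.2.2.mono tsub_le_self⟩, rfl,
    (add_tsub_cancel_of_le hle).symm⟩
  exact hne (le_antisymm (tsub_eq_zero_iff_le.1 h) hle)

theorem LetterMatching.exists_source {L : Set (Fin n)} {w : StdMon m a} {i : Fin n} (q : Cell m a)
    (hi : IsLeast (lettersIn L w.1) i) (hne : w.1 ≠ Finsupp.single i 1) :
    ∃ c, LetterMatching m a L c (w :: q) := by
  obtain ⟨u, v, hu, hw⟩ := w.exists_eq_add hi.1.2 hne
  exact ⟨_, .head L u v w q i hi hu hw⟩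

/-! ### Termination of the steps -/

open Classical in
/-- The sequence of letters that are forced at the beginning of the cell, padded by `n` to a
sequence of length `N` and read as a number in base `n + 1`. -/
noncomputable def letterValue : ℕ → Set (Fin n) → Cell m a → ℕ
  | 0, _, _ => 0
  | N + 1, _, [] => (n + 1) ^ (N + 1) - 1
  | N + 1, L, w :: c =>
    if h : ∃ i, IsLeast (lettersIn L w.1) i then
      h.choose * (n + 1) ^ N +
        if w.1 = Finsupp.single h.choose 1 then letterValue N (nextLetters m a L h.choose) c
        else (n + 1) ^ N - 1
    else (n + 1) ^ (N + 1) - 1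

theorem letterValue_of_eq_empty {L : Set (Fin n)} {w : StdMon m a}
    (h : lettersIn L w.1 = ∅) (N : ℕ) (c : Cell m a) :
    letterValue N L (w :: c) = (n + 1) ^ N - 1 := by
  match N with
  | 0 => simp [letterValue]
  | N + 1 =>
    rw [letterValue, dif_neg]
    rintro ⟨i, hi⟩
    exact Set.eq_empty_iff_forall_notMem.1 h i hi.1

theorem letterValue_of_ne {L : Set (Fin n)} {w : StdMon m a} {i : Fin n}
    (hi : IsLeast (lettersIn L w.1) i) (hne : w.1 ≠ Finsupp.single i 1) (N : ℕ) (c : Cell m a) :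
    letterValue (N + 1) L (w :: c) = i * (n + 1) ^ N + ((n + 1) ^ N - 1) := by
  have h : ∃ i, IsLeast (lettersIn L w.1) i := ⟨i, hi⟩
  obtain rfl := hi.unique h.choose_spec
  rw [letterValue, dif_pos h, if_neg hne]

theorem letterValue_of_eq {L : Set (Fin n)} {w : StdMon m a} {i : Fin n}
    (hi : i ∈ L) (heq : w.1 = Finsupp.single i 1) (N : ℕ) (c : Cell m a) :
    letterValue (N + 1) L (w :: c) =
      i * (n + 1) ^ N + letterValue N (nextLetters m a L i) c := by
  have hi : IsLeast (lettersIn L w.1) i := by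
    refine ⟨⟨hi, by simp [heq]⟩, ?_⟩
    rintro l ⟨-, hl⟩
    rw [heq, Finsupp.single_apply_ne_zero] at hl
    exact hl.1.ge
  have h : ∃ i, IsLeast (lettersIn L w.1) i := ⟨i, hi⟩
  obtain rfl := hi.unique h.choose_spec
  rw [letterValue, dif_pos h, if_pos heq]

theorem letterValue_lt (N : ℕ) (L : Set (Fin n)) (c : Cell m a) :
    letterValue N L c < (n + 1) ^ N := by
  induction N generalizing L c with
  | zero => simp [letterValue]
  | succ N ih =>
    have hpos : 0 < (n + 1) ^ (N + 1) := by positivity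
    have hpos' : 0 < (n + 1) ^ N := by positivity
    match c with
    | [] =>
      rw [letterValue]
      omega
    | w :: c =>
      rcases (lettersIn L w.1).eq_empty_or_nonempty with h | h
      · rw [letterValue_of_eq_empty h]
        omega
      · obtain ⟨i, hi⟩ := exists_isLeast_fin h
        have h1 : (i + 1) * (n + 1) ^ N ≤ n * (n + 1) ^ N :=
          Nat.mul_le_mul_right _ i.2
        rw [add_mul, one_mul] at h1
        have h2 : (n + 1) ^ (N + 1) = n * (n + 1) ^ N + (n + 1) ^ N := by ring
        by_cases hne : w.1 = Finsupp.single i 1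
        · rw [letterValue_of_eq hi.1.1 hne]
          have := ih (nextLetters m a L i) c
          omega
        · rw [letterValue_of_ne hi hne]
          omega

/-- On both sides of the edge the scan reads i at the position of the split and the padding digit n
from there on: the target stops at the product, the source at the cofactor without admissible
letters. -/
theorem LetterMatching.letterValue_eq {L : Set (Fin n)} {c d : Cell m a}
    (h : LetterMatching m a L c d) (N : ℕ) : letterValue N L c = letterValue N L d := by
  induction h generalizing N with
  | head L u v w q i hi hu hw =>
    match N with
    | 0 => simp [letterValue]
    | N + 1 =>
      have hne : w.1 ≠ Finsupp.single i 1 := by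
        rw [hw]
        exact StdMon.add_ne_single _ _ _
      rw [letterValue_of_ne hi hne, letterValue_of_eq hi.1.1 hu,
        letterValue_of_eq_empty (lettersIn_eq_empty hi hu hw)]
  | cons L u c d i hi hu h ih =>
    match N with
    | 0 => simp [letterValue]
    | N + 1 => rw [letterValue_of_eq hi hu, letterValue_of_eq hi hu, ih]

/-- Multiplying two neighbours does not increase the value, and if it preserves the value then it
does not produce a new target of a matching edge, unless it is itself a matching edge. -/
theorem StdMerges.letterValue_le {c d : Cell m a} (h : StdMerges m a c d) (L : Set (Fin n)) (N : ℕ)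
    (hN : c.length ≤ N) :
    letterValue N L d ≤ letterValue N L c ∧
      (letterValue N L d = letterValue N L c → (∃ e, LetterMatching m a L e d) →
        LetterMatching m a L c d ∨ ∃ e, LetterMatching m a L e c) := by
  induction h generalizing L N with
  | head u v w q h =>
    obtain ⟨N, rfl⟩ : ∃ N', N = N' + 1 := ⟨N - 1, by simp at hN; omega⟩
    have hpos : 0 < (n + 1) ^ N := by positivity
    have hne : ∀ i, w.1 ≠ Finsupp.single i 1 := fun i => by
      rw [h]
      exact StdMon.add_ne_single _ _ _
    rcases (lettersIn L u.1).eq_empty_or_nonempty with hu | hu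
    · rw [letterValue_of_eq_empty hu]
      -- All digits of the source equal n, the maximal value. A target starts with a digit j < n, so
      -- equality is impossible for it.
      refine ⟨Nat.le_sub_one_of_lt (letterValue_lt _ _ _), fun heq ⟨e, he⟩ => ?_⟩
      obtain ⟨j, hj⟩ := exists_isLeast_fin he.valid_target
      rw [letterValue_of_ne hj (hne j)] at heq
      have h1 : (j + 1) * (n + 1) ^ N ≤ n * (n + 1) ^ N := Nat.mul_le_mul_right _ j.2
      have h2 : (n + 1) ^ (N + 1) = n * (n + 1) ^ N + (n + 1) ^ N := by ring
      rw [add_mul, one_mul] at h1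
      omega
    · obtain ⟨i, hi⟩ := exists_isLeast_fin hu
      have hiw : i ∈ lettersIn L w.1 := ⟨hi.1.1, by simp [h, hi.1.2]⟩
      obtain ⟨j, hj⟩ := exists_isLeast_fin ⟨i, hiw⟩
      have hji : j ≤ i := hj.2 hiw
      rw [letterValue_of_ne hj (hne j)]
      by_cases hui : u.1 = Finsupp.single i 1
      · rw [letterValue_of_eq hi.1.1 hui]
        -- A smaller letter j contributed by `v` lowers the leading digit, which outweighs all later
        -- ones. If the least letter stays i, this merge is itself the matching edge.
        rcases hji.lt_or_eq with hlt | rfl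
        · have h1 : (j + 1) * (n + 1) ^ N ≤ i * (n + 1) ^ N := Nat.mul_le_mul_right _ hlt
          rw [add_mul, one_mul] at h1
          exact ⟨by omega, fun heq => by omega⟩
        · rw [letterValue_of_eq_empty (lettersIn_eq_empty hj hui h)]
          exact ⟨le_rfl, fun _ _ => .inl (.head _ _ _ _ _ _ hj hui h)⟩
      -- Here `u` has an admissible letter without being that letter, so the source cell is itself a
      -- target of the matching.
      · rw [letterValue_of_ne hi hui]
        have h1 : (j : ℕ) * (n + 1) ^ N ≤ i * (n + 1) ^ N := Nat.mul_le_mul_right _ hji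
        exact ⟨by omega, fun _ _ => .inr (LetterMatching.exists_source _ hi hui)⟩
  | cons u c d h ih =>
    obtain ⟨N, rfl⟩ : ∃ N', N = N' + 1 := ⟨N - 1, by simp at hN; omega⟩
    rcases (lettersIn L u.1).eq_empty_or_nonempty with hu | hu
    · rw [letterValue_of_eq_empty hu, letterValue_of_eq_empty hu]
      refine ⟨le_rfl, fun _ ⟨e, he⟩ => ?_⟩
      have := he.valid_target
      rw [hu] at this
      exact (Set.not_nonempty_empty this).elim
    · obtain ⟨i, hi⟩ := exists_isLeast_fin hu
      by_cases hui : u.1 = Finsupp.single i 1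
      · rw [letterValue_of_eq hi.1.1 hui, letterValue_of_eq hi.1.1 hui]
        obtain ⟨h1, h2⟩ := ih (nextLetters m a L i) N (by simpa using hN)
        refine ⟨by omega, fun heq ⟨e, he⟩ => ?_⟩
        have he' : ∃ e, LetterMatching m a (nextLetters m a L i) e d := by
          cases he with
          | head _ u' v w q j hj hu' hw' =>
            rw [hw'] at hui
            exact (StdMon.add_ne_single _ _ _ hui).elim
          | cons _ _ e _ j hj hu' h' =>
            obtain rfl := eq_of_single_eq hui hu'
            exact ⟨e, h'⟩
        rcases h2 (by omega) he' with h3 | ⟨e', h3⟩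
        · exact .inl (.cons _ _ _ _ _ hi.1.1 hui h3)
        · exact .inr ⟨_, .cons _ _ _ _ _ hi.1.1 hui h3⟩
      · rw [letterValue_of_ne hi hui, letterValue_of_ne hi hui]
        exact ⟨le_rfl, fun _ _ => .inr (LetterMatching.exists_source _ hi hui)⟩

open Classical in
/-- The last component of the quantity that decreases along the steps of `G_M`. -/
noncomputable def cellRank (c : Cell m a) : ℕ :=
  -- A reversed edge raises the length by one, adding 2, and leads from a target to a cell that is
  -- no target, losing 3. An inner step that keeps the letter value drops 2 and does not gain the 3.
  2 * c.length + if ∃ e, LetterMatching m a Set.univ e c then 3 else 0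

/-- The quantity that decreases along the steps of `G_M`. -/
noncomputable def cellMeasure (c : Cell m a) : m.syn × ℕ × ℕ :=
  (m.toSyn (Cell.total c), letterValue (Cell.total c).degree Set.univ c, cellRank c)

/-- Outer terms and lower terms of normal forms lower the total product. Genuine merges keep it and
are controlled by `StdMerges.letterValue_le`; reversed edges keep product and letter value and lower
the rank. The number of digits is the degree of the total product: it bounds the length and is the
same for cells with equal products, whose values are thus comparable. -/
theorem wellFounded_step :
    WellFounded (Function.swap
      (AlgMorse.Step (barD m a) (LetterMatching m a Set.univ))) := by
  refine Subrelation.wf (r := InvImage (Prod.Lex (· < ·) (Prod.Lex (· < ·) (· < ·)))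
    (cellMeasure (m := m) (a := a))) ?_ (InvImage.wf _
      (wellFounded_lt.prod_lex (wellFounded_lt.prod_lex wellFounded_lt)))
  intro d c h
  change Prod.Lex _ _ (cellMeasure d) (cellMeasure c)
  unfold cellMeasure
  rcases h with ⟨hD, hM⟩ | hM
  · rcases Merges.of_barD_ne_zero hD with ⟨w, rfl⟩ | hm
    · refine .left _ _ (m.toSyn_strictMono ?_)
      rw [Cell.total_cons]
      exact lt_add_of_pos_left _ (pos_iff_ne_zero.2 w.2.1)
    · rcases hm.lt_or_stdMerges with hlt | hs
      · exact .left _ _ hlt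
      · rw [hs.total_eq]
        refine .right _ ?_
        obtain ⟨h1, h2⟩ := hs.letterValue_le Set.univ (Cell.total c).degree
          (Cell.length_le_degree_total c)
        rcases h1.lt_or_eq with h1 | h1
        · exact .left _ _ h1
        · rw [h1]
          refine .right _ ?_
          have hlen := hm.length_eq
          unfold cellRank
          by_cases hd : ∃ e, LetterMatching m a Set.univ e d
          · rw [if_pos hd, if_pos ((h2 h1 hd).resolve_left hM)]
            omega
          · rw [if_neg hd]
            omega
  · rw [hM.stdMerges.total_eq, hM.letterValue_eq]
    refine .right _ (.right _ ?_)
    have hlen := hM.stdMerges.length_eq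
    have hd : ¬ ∃ e, LetterMatching m a Set.univ e d := fun ⟨e, he⟩ => he.not_source_of_target hM
    unfold cellRank
    rw [if_neg hd, if_pos ⟨d, hM⟩]
    omega

end Combinatorics

/-! ### Identification of the given matching with the scan, and the critical cells -/

section Matching

variable {m : MonomialOrder (Fin n)} {a : Ideal (MvPolynomial (Fin n) k)}

variable (m a) in
/-- The edges of `LetterMatching` in a given coordinate position. -/
def LetterMatchingAt : ℕ → Set (Fin n) → Cell m a → Cell m a → Prop
  | 0, L, c, d => ∃ (u v w : StdMon m a) (q : Cell m a) (i : Fin n),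
      c = u :: v :: q ∧ d = w :: q ∧ IsLeast (lettersIn L w.1) i ∧ u.1 = Finsupp.single i 1 ∧
        w.1 = u.1 + v.1
  | j + 1, L, c, d => ∃ (u : StdMon m a) (c' d' : Cell m a) (i : Fin n),
      c = u :: c' ∧ d = u :: d' ∧ i ∈ L ∧ u.1 = Finsupp.single i 1 ∧
        LetterMatchingAt j (nextLetters m a L i) c' d'

theorem letterMatching_iff {L : Set (Fin n)} {c d : Cell m a} :
    LetterMatching m a L c d ↔ ∃ j, LetterMatchingAt m a j L c d := by
  constructor
  · intro h
    induction h with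
    | head L u v w q i hi hu hw => exact ⟨0, u, v, w, q, i, rfl, rfl, hi, hu, hw⟩
    | cons L u c d i hi hu h ih =>
      obtain ⟨j, hj⟩ := ih
      exact ⟨j + 1, u, c, d, i, rfl, rfl, hi, hu, hj⟩
  · rintro ⟨j, h⟩
    induction j generalizing L c d with
    | zero =>
      obtain ⟨u, v, w, q, i, rfl, rfl, hi, hu, hw⟩ := h
      exact .head _ _ _ _ _ _ hi hu hw
    | succ j ih =>
      obtain ⟨u, c, d, i, rfl, rfl, hi, hu, h⟩ := h
      exact .cons _ _ _ _ _ hi hu (ih h)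

variable (m a) in
/-- The cells that lie on no edge in the first `j` positions. -/
def LetterRemaining : ℕ → Set (Fin n) → Cell m a → Prop
  | _, _, [] => True
  | 0, L, w :: _ => (lettersIn L w.1).Nonempty
  | j + 1, L, w :: c =>
    ∃ i ∈ L, w.1 = Finsupp.single i 1 ∧ LetterRemaining j (nextLetters m a L i) c

theorem letterRemaining_cons {j : ℕ} {L : Set (Fin n)} {w : StdMon m a} {i : Fin n} (hi : i ∈ L)
    (hw : w.1 = Finsupp.single i 1) (c : Cell m a) :
    LetterRemaining m a (j + 1) L (w :: c) ↔ LetterRemaining m a j (nextLetters m a L i) c := by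
  constructor
  · rintro ⟨i', -, hw', h⟩
    obtain rfl := eq_of_single_eq hw hw'
    exact h
  · exact fun h => ⟨i, hi, hw, h⟩

/-- If no letter of `v` may follow `x_i`, then `x_i v` is standard. -/
theorem IsQuadratic.isStandard_add (hq : IsQuadratic m a) {L : Set (Fin n)} {i : Fin n}
    {w v : StdMon m a} (hw : w.1 = Finsupp.single i 1)
    (h : lettersIn (nextLetters m a L i) v.1 = ∅) : IsStandard m a (w.1 + v.1) := by
  by_contra hns
  obtain ⟨i', l, hi', hl, hil⟩ := hq.exists_of_add _ _ w.2.2 v.2.2 hns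
  rw [hw, Finsupp.single_apply_ne_zero] at hi'
  obtain rfl := hi'.1
  exact Set.eq_empty_iff_forall_notMem.1 h l ⟨.inl hil, hl⟩

/-- A smaller letter of `L` in the product would have to divide `v`, and the second clause of
`nextLetters` would make it admissible there. -/
theorem isLeast_lettersIn_add {L : Set (Fin n)} {i : Fin n} (hi : i ∈ L)
    {w v : StdMon m a} (hw : w.1 = Finsupp.single i 1)
    (h : lettersIn (nextLetters m a L i) v.1 = ∅) : IsLeast (lettersIn L (w.1 + v.1)) i := by
  refine ⟨⟨hi, by simp [hw]⟩, ?_⟩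
  rintro l ⟨hlL, hl⟩
  by_contra hli
  have hli : l < i := not_le.1 hli
  refine Set.eq_empty_iff_forall_notMem.1 h l ⟨.inr ⟨hli, hlL⟩, fun h0 => hl ?_⟩
  simp [hw, h0, hli.ne]

/-- At the current position the entry has an admissible letter. Not being a target forces it to be a
single variable x_i. Not being a source forces the next entry, if any, to have an admissible letter,
for otherwise `IsQuadratic.isStandard_add` and `isLeast_lettersIn_add` would permit merging the two.
-/
theorem letterRemaining_succ_iff (hq : IsQuadratic m a) {j : ℕ} {L : Set (Fin n)} {c : Cell m a} :
    LetterRemaining m a (j + 1) L c ↔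
      LetterRemaining m a j L c ∧ AlgMorse.IsCritical (LetterMatchingAt m a j L) c := by
  induction j generalizing L c with
  | zero =>
    match c with
    | [] =>
      refine ⟨fun _ => ⟨by simp [LetterRemaining], fun d => ⟨?_, ?_⟩⟩,
        fun _ => by simp [LetterRemaining]⟩
      · rintro ⟨u, v, w, q, i, h, -⟩
        simp at h
      · rintro ⟨u, v, w, q, i, -, h, -⟩
        simp at h
    | w :: c =>
      constructor
      · rintro ⟨i, hi, hw, h⟩
        refine ⟨⟨i, hi, by simp [hw]⟩, fun d => ⟨?_, ?_⟩⟩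
        · rintro ⟨u, v, w', q, i', h1, rfl, hi', hu, hw'⟩
          obtain ⟨rfl, rfl⟩ := List.cons.inj h1
          obtain rfl := eq_of_single_eq hw hu
          have h : (lettersIn _ v.1).Nonempty := h
          rw [lettersIn_eq_empty hi' hu hw'] at h
          exact Set.not_nonempty_empty h
        · rintro ⟨u, v, w', q, i', rfl, h1, hi', hu, hw'⟩
          obtain ⟨rfl, rfl⟩ := List.cons.inj h1
          exact StdMon.add_ne_single u v i (hw'.symm.trans hw)
      · rintro ⟨h, hc⟩
        obtain ⟨i, hi⟩ := exists_isLeast_fin h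
        have hwi : w.1 = Finsupp.single i 1 := by
          by_contra hne
          obtain ⟨u, v, hu, hw⟩ := w.exists_eq_add hi.1.2 hne
          exact (hc _).2 ⟨u, v, w, c, i, rfl, rfl, hi, hu, hw⟩
        refine ⟨i, hi.1.1, hwi, ?_⟩
        match c, hc with
        | [], _ => simp [LetterRemaining]
        | v :: q, hc =>
          change (lettersIn _ v.1).Nonempty
          by_contra hemp
          rw [Set.not_nonempty_iff_eq_empty] at hemp
          have hstd := hq.isStandard_add hwi hemp
          have hleast := isLeast_lettersIn_add hi.1.1 hwi hemp
          have h0 : w.1 + v.1 ≠ 0 := fun h0 => w.2.1 (add_eq_zero.1 h0).1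
          exact (hc _).1 ⟨w, v, ⟨w.1 + v.1, h0, hstd⟩, q, i, rfl, rfl, hleast, hwi, rfl⟩
  | succ j ih =>
    match c with
    | [] =>
      refine ⟨fun _ => ⟨by simp [LetterRemaining], fun d => ⟨?_, ?_⟩⟩,
        fun _ => by simp [LetterRemaining]⟩
      · rintro ⟨u, c, d, i, h, -⟩
        simp at h
      · rintro ⟨u, c, d, i, -, h, -⟩
        simp at h
    | w :: c =>
      constructor
      · rintro ⟨i, hi, hw, h⟩
        rw [ih] at h
        refine ⟨⟨i, hi, hw, h.1⟩, fun d => ⟨?_, ?_⟩⟩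
        · rintro ⟨u, c', d', i', h1, rfl, hi', hu, h2⟩
          obtain ⟨rfl, rfl⟩ := List.cons.inj h1
          obtain rfl := eq_of_single_eq hw hu
          exact (h.2 d').1 h2
        · rintro ⟨u, d', c', i', rfl, h1, hi', hu, h2⟩
          obtain ⟨rfl, rfl⟩ := List.cons.inj h1
          obtain rfl := eq_of_single_eq hw hu
          exact (h.2 d').2 h2
      · rintro ⟨⟨i, hi, hw, h⟩, hc⟩
        refine ⟨i, hi, hw, ih.2 ⟨h, fun d => ⟨fun hd => ?_, fun hd => ?_⟩⟩⟩
        · exact (hc (w :: d)).1 ⟨w, c, d, i, rfl, rfl, hi, hw, hd⟩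
        · exact (hc (w :: d)).2 ⟨w, d, c, i, rfl, rfl, hi, hw, hd⟩

theorem LetterRemaining.degree_total {N : ℕ} {L : Set (Fin n)} {c : Cell m a}
    (h : LetterRemaining m a N L c) (hN : c.length ≤ N) :
    (Cell.total c).degree = c.length := by
  induction N generalizing L c with
  | zero =>
    obtain rfl : c = [] := by simpa using hN
    simp
  | succ N ih =>
    match c, h with
    | [], _ => simp
    | w :: c, ⟨i, _, hw, h⟩ =>
      rw [Cell.total_cons, map_add, hw, Finsupp.degree_single, ih h (by simpa using hN),
        List.length_cons, add_comm]

theorem isSplitting_cons {j : ℕ} {L : Set (Fin n)} {x : StdMon m a} {i : Fin n} (hi : i ∈ L)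
    (hx : x.1 = Finsupp.single i 1) (p : Cell m a) (w : StdMon m a) (q : Cell m a)
    (u : StdMon m a) :
    IsSplitting m a {c | LetterRemaining m a (j + 1) L c} (x :: p) w q u ↔
      IsSplitting m a {c | LetterRemaining m a j (nextLetters m a L i) c} p w q u := by
  simp only [IsSplitting, List.cons_append, Set.mem_ofPred_eq, letterRemaining_cons hi hx]

/-- A divisor may be split off as soon as it contains an admissible letter, so the divisors minimal
for this are the admissible variables themselves. The largest of them in the monomial order has the
least index, which links the order rule to the scan. -/
theorem isSplitting_nil_iff {L : Set (Fin n)} {w : StdMon m a} (q : Cell m a) (u : StdMon m a) :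
    IsSplitting m a {c | LetterRemaining m a 0 L c} [] w q u ↔
      ∃ i ∈ lettersIn L w.1, u.1 = Finsupp.single i 1 ∧ w.1 ≠ Finsupp.single i 1 := by
  constructor
  · rintro ⟨⟨u', hw, i, hi, hui⟩, hmin⟩
    have hiw : i ∈ lettersIn L w.1 := ⟨hi, by simp [hw, hui]⟩
    have hne : w.1 ≠ Finsupp.single i 1 := by
      rw [hw]
      exact StdMon.add_ne_single _ _ _
    refine ⟨i, hiw, ?_, hne⟩
    obtain ⟨x, v, hx, hv⟩ := w.exists_eq_add hiw.2 hne
    by_contra hu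
    refine hmin x v ?_ ?_ hv ⟨i, hi, by simp [hx]⟩
    · rw [hx, Finsupp.single_le_iff]
      exact Nat.one_le_iff_ne_zero.2 hui
    · rintro rfl
      exact hu hx
  · rintro ⟨i, hi, hu, hne⟩
    obtain ⟨x, v, hx, hv⟩ := w.exists_eq_add hi.2 hne
    obtain rfl : u = x := Subtype.ext (hu.trans hx.symm)
    refine ⟨⟨v, hv, i, hi.1, by simp [hu]⟩, fun t t' htu htne ht => (htne ?_).elim⟩
    refine Subtype.ext (le_antisymm htu ?_)
    obtain ⟨l, hl⟩ := Finsupp.ne_iff.1 t.2.1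
    have h1 := htu l
    rw [hu] at h1 ⊢
    by_cases hil : l = i
    · subst hil
      rw [Finsupp.single_le_iff]
      exact Nat.one_le_iff_ne_zero.2 hl
    · rw [Finsupp.single_eq_of_ne hil] at h1
      exact (hl (Nat.le_zero.1 h1)).elim

/-- The matching rule of `laterMatching` for the letters. -/
theorem letterMatchingAt_iff
    (hvar : ∀ i j : Fin n, i < j → Finsupp.single j 1 ≺[m] Finsupp.single i 1)
    {j : ℕ} {L : Set (Fin n)} {c d : Cell m a} :
    LetterMatchingAt m a j L c d ↔
      ∃ (p q : Cell m a) (u₁ u₂ w : StdMon m a),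
        p.length = j ∧ c = p ++ u₁ :: u₂ :: q ∧ d = p ++ w :: q ∧ w.1 = u₁.1 + u₂.1 ∧
        c ∈ {c | LetterRemaining m a j L c} ∧ d ∈ {c | LetterRemaining m a j L c} ∧
        IsSplitting m a {c | LetterRemaining m a j L c} p w q u₁ ∧
        ∀ u, IsSplitting m a {c | LetterRemaining m a j L c} p w q u → u.1 ≼[m] u₁.1 := by
  induction j generalizing L c d with
  | zero =>
    constructor
    · rintro ⟨u, v, w, q, i, rfl, rfl, hi, hu, hw⟩
      refine ⟨[], q, u, v, w, rfl, rfl, rfl, hw, ⟨i, hi.1.1, by simp [hu]⟩, ⟨i, hi.1⟩, ?_, ?_⟩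
      · rw [isSplitting_nil_iff]
        refine ⟨i, hi.1, hu, ?_⟩
        rw [hw]
        exact StdMon.add_ne_single _ _ _
      · intro t ht
        obtain ⟨l, hl, htl, -⟩ := (isSplitting_nil_iff _ _).1 ht
        rw [htl, hu]
        rcases (hi.2 hl).lt_or_eq with h | rfl
        · exact (hvar _ _ h).le
        · exact le_rfl
    · rintro ⟨p, q, u, v, w, hp, rfl, rfl, hw, -, -, hs, hmax⟩
      obtain rfl := List.length_eq_zero_iff.1 hp
      obtain ⟨i, hi, hu, hne⟩ := (isSplitting_nil_iff _ _).1 hs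
      refine ⟨u, v, w, q, i, rfl, rfl, ⟨hi, fun l hl => ?_⟩, hu, hw⟩
      have hne' : w.1 ≠ Finsupp.single l 1 := by
        rw [hw]
        exact StdMon.add_ne_single _ _ _
      obtain ⟨x, y, hx, -⟩ := w.exists_eq_add hl.2 hne'
      have := hmax x ((isSplitting_nil_iff _ _).2 ⟨l, hl, hx, hne'⟩)
      rw [hx, hu] at this
      exact not_lt.1 fun hli => absurd this (not_le.2 (hvar _ _ hli))
  | succ j ih =>
    constructor
    · rintro ⟨x, c', d', i, rfl, rfl, hi, hx, h⟩
      obtain ⟨p, q, u, v, w, hp, rfl, rfl, hw, hc, hd, hs, hmax⟩ := ih.1 h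
      refine ⟨x :: p, q, u, v, w, by simp [hp], rfl, rfl, hw,
        (letterRemaining_cons hi hx _).2 hc, (letterRemaining_cons hi hx _).2 hd, ?_, ?_⟩
      · rwa [isSplitting_cons hi hx]
      · simpa only [isSplitting_cons hi hx] using hmax
    · rintro ⟨p, q, u, v, w, hp, rfl, rfl, hw, hc, hd, hs, hmax⟩
      match p, hp, hc, hd, hs, hmax with
      | x :: p, hp, hc, hd, hs, hmax =>
        obtain ⟨i, hi, hx, hc⟩ := hc
        refine ⟨x, _, _, i, rfl, rfl, hi, hx, ih.2
          ⟨p, q, u, v, w, by simpa using hp, rfl, rfl, hw, hc,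
            (letterRemaining_cons hi hx _).1 hd, ?_, ?_⟩⟩
        · rwa [isSplitting_cons hi hx] at hs
        · simpa only [isSplitting_cons hi hx] using hmax

theorem IsQuadratic.nontrivial (hq : IsQuadratic m a) : Nontrivial (QuotAlg a) := by
  refine Ideal.Quotient.nontrivial_iff.2 fun h => ?_
  refine hq.standard_of_degree_le 0 (by simp) 1 ?_ one_ne_zero m.degree_one
  rw [h]
  trivial

theorem barD_ne_zero_of_letterMatching (hq : IsQuadratic m a) {L : Set (Fin n)} {c d : Cell m a}
    (h : LetterMatching m a L c d) : barD m a c d ≠ 0 :=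
  have := hq.nontrivial
  h.stdMerges.isUnit_barD.ne_zero

/-- In the first position all letters are admissible, so the least admissible letter is the least
letter dividing the entry. The required nonvanishing of the coefficient is automatic, as genuine
merges have unit coefficients. -/
theorem matchingAt_iff (hq : IsQuadratic m a)
    (hvar : ∀ i j : Fin n, i < j → Finsupp.single j 1 ≺[m] Finsupp.single i 1)
    {j : ℕ} {c d : Cell m a} :
    matchingAt m a j {c | LetterRemaining m a j Set.univ c} c d ↔
      LetterMatchingAt m a j Set.univ c d := by
  match j with
  | 0 =>
    have h : ∀ w : Fin n →₀ ℕ, lettersIn Set.univ w = {l | w l ≠ 0} := fun w => by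
      simp [lettersIn]
    constructor
    · rintro ⟨x, w', w, q, i, rfl, rfl, -, hi, hx, hw⟩
      exact ⟨x, w', w, q, i, rfl, rfl, by rwa [h], hx, hw⟩
    · intro hM
      have hD := barD_ne_zero_of_letterMatching hq (letterMatching_iff.2 ⟨0, hM⟩)
      obtain ⟨x, w', w, q, i, rfl, rfl, hi, hx, hw⟩ := hM
      exact ⟨x, w', w, q, i, rfl, rfl, hD, by rwa [h] at hi, hx, hw⟩
  | j + 1 =>
    constructor
    · rintro ⟨p, q, u, v, w, h1, h2, h3, h4, -, h5⟩
      exact (letterMatchingAt_iff hvar).2 ⟨p, q, u, v, w, h1, h2, h3, h4, h5⟩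
    · intro hM
      have hD := barD_ne_zero_of_letterMatching hq (letterMatching_iff.2 ⟨j + 1, hM⟩)
      obtain ⟨p, q, u, v, w, h1, h2, h3, h4, h5⟩ := (letterMatchingAt_iff hvar).1 hM
      exact ⟨p, q, u, v, w, h1, h2, h3, h4, hD, h5⟩

theorem remaining_eq (hq : IsQuadratic m a)
    (hvar : ∀ i j : Fin n, i < j → Finsupp.single j 1 ≺[m] Finsupp.single i 1) (j : ℕ) :
    remaining m a j = {c | LetterRemaining m a j Set.univ c} := by
  induction j with
  | zero =>
    refine (Set.eq_univ_of_forall fun c => ?_).symm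
    match c with
    | [] => simp [LetterRemaining]
    | w :: c =>
      obtain ⟨i, hi⟩ := Finsupp.ne_iff.1 w.2.1
      exact ⟨i, trivial, hi⟩
  | succ j ih =>
    ext c
    rw [remaining, ih, Set.mem_ofPred_eq, Set.mem_ofPred_eq, Set.mem_ofPred_eq,
      letterRemaining_succ_iff hq]
    simp only [AlgMorse.IsCritical, matchingAt_iff hq hvar]

theorem matching_eq (hq : IsQuadratic m a)
    (hvar : ∀ i j : Fin n, i < j → Finsupp.single j 1 ≺[m] Finsupp.single i 1) :
    matching m a = LetterMatching m a Set.univ := by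
  ext c d
  simp only [matching, remaining_eq hq hvar, matchingAt_iff hq hvar, letterMatching_iff]

/-- A critical cell survives every position, and surviving as many positions as it has entries makes
each entry a variable. -/
theorem degree_total_of_isCritical (hq : IsQuadratic m a) {c : Cell m a}
    (hc : AlgMorse.IsCritical (LetterMatching m a Set.univ) c) :
    (Cell.total c).degree = c.length := by
  have h : ∀ j, LetterRemaining m a j Set.univ c := by
    intro j
    induction j with
    | zero =>
      match c with
      | [] => simp [LetterRemaining]
      | w :: c =>
        obtain ⟨i, hi⟩ := Finsupp.ne_iff.1 w.2.1
        exact ⟨i, trivial, hi⟩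
    | succ j ih =>
      refine (letterRemaining_succ_iff hq).2 ⟨ih, fun d => ⟨fun h => ?_, fun h => ?_⟩⟩
      · exact (hc d).1 (letterMatching_iff.2 ⟨j, h⟩)
      · exact (hc d).2 (letterMatching_iff.2 ⟨j, h⟩)
  exact (h c.length).degree_total le_rfl

theorem isAcyclicMatching (hq : IsQuadratic m a) :
    AlgMorse.IsAcyclicMatching (barD m a) (LetterMatching m a Set.univ) where
  edge _ _ h := barD_ne_zero_of_letterMatching hq h
  matching v b c b' c' h h' hv hv' := by
    rcases hv with rfl | rfl <;> rcases hv' with rfl | rfl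
    · exact ⟨rfl, (h.target_unique h').symm⟩
    · exact (h'.not_source_of_target h).elim
    · exact (h.not_source_of_target h').elim
    · exact ⟨(h.source_unique h').symm, rfl⟩
  invertible _ _ h := h.stdMerges.isUnit_barD
  acyclic c h := by
    have hwf := (wellFounded_step (m := m) (a := a)).transGen
    refine hwf.irrefl.irrefl c ?_
    rwa [Relation.transGen_swap]

/-- Reversed edges preserve the total product, so a step that lowers its degree is an ordinary edge
and falls under `barD_mem_maxIdeal`. -/
theorem Gam_mem_maxIdeal (hq : IsQuadratic m a) {c e : Cell m a}
    (h : (Cell.total e).degree < (Cell.total c).degree) :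
    AlgMorse.Gam (barD m a) (LetterMatching m a Set.univ) c e ∈ maxIdeal a := by
  refine AlgMorse.Gam_mem (t := fun c => (Cell.total c).degree) (fun c d _ hlt => ?_) h
  rw [AlgMorse.stepWeight, if_neg]
  · exact barD_mem_maxIdeal hq hlt
  · intro h
    rw [h.stdMerges.total_eq] at hlt
    exact lt_irrefl _ hlt

end Matching

/-! ### The minimal resolution -/

section Resolution

open AlgMorse

variable {m : MonomialOrder (Fin n)} {a : Ideal (MvPolynomial (Fin n) k)}

theorem isCritical_nil : IsCritical (LetterMatching m a Set.univ) [] :=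
  fun _ => ⟨nofun, nofun⟩

theorem range_letterMorseD_le (hq : IsQuadratic m a) (i : ℕ) :
    LinearMap.range (morseD (barD m a) (LetterMatching m a Set.univ) List.length i) ≤
      maxIdeal a • (⊤ : Submodule (QuotAlg a)
        (MorseModule (QuotAlg a) (LetterMatching m a Set.univ) List.length i)) := by
  refine range_morseD_le (isAcyclicMatching hq) wellFounded_step _ i fun c e => ?_
  refine Gam_mem_maxIdeal hq ?_
  rw [degree_total_of_isCritical hq c.2.1, degree_total_of_isCritical hq e.2.1, c.2.2, e.2.2]
  exact Nat.lt_succ_self i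

end Resolution

end CommAnick

theorem corollary3p5 {k : Type*} [Field k] {n : ℕ} (m : MonomialOrder (Fin n))
    (hdeg : CommAnick.IsDegreeOrder m)
    (hvar : ∀ i j : Fin n, i < j → Finsupp.single j 1 ≺[m] Finsupp.single i 1)
    (a : Ideal (MvPolynomial (Fin n) k)) (B : Set (MvPolynomial (Fin n) k))
    (hB : CommAnick.IsGroebnerBasis m B a) (hquad : ∀ b ∈ B, b.IsHomogeneous 2) :
    -- the Morse complex is well defined: acyclic matching, only finitely many paths from each cell
    AlgMorse.IsAcyclicMatching (CommAnick.barD m a) (CommAnick.matching m a) ∧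
    (∀ c : CommAnick.Cell m a,
      {p | AlgMorse.IsPath (CommAnick.barD m a) (CommAnick.matching m a) p ∧
        p.head? = some c}.Finite) ∧
    -- it is a resolution of the residue class field
    Function.Surjective (CommAnick.augF m a) ∧
    Function.Exact (CommAnick.dF m a 0) (CommAnick.augF m a) ∧
    (∀ i, Function.Exact (CommAnick.dF m a (i + 1)) (CommAnick.dF m a i)) ∧
    -- which is minimal
    (∀ i, LinearMap.range (CommAnick.dF m a i) ≤
      CommAnick.maxIdeal a • (⊤ : Submodule (CommAnick.QuotAlg a) (CommAnick.F m a i))) := by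
  have hq := hB.isQuadratic hquad
  unfold CommAnick.augF CommAnick.dF CommAnick.F
  rw [CommAnick.matching_eq hq hvar]
  have hM := CommAnick.isAcyclicMatching hq
  have hwf := CommAnick.wellFounded_step (m := m) (a := a)
  have hlen := CommAnick.length_eq_of_barD_ne_zero (m := m) (a := a)
  have hDD := CommAnick.totalD_totalD hq
  let e : AlgMorse.CriticalCell (CommAnick.LetterMatching m a Set.univ) List.length 0 :=
    ⟨[], CommAnick.isCritical_nil, rfl⟩
  have he : ∀ c : AlgMorse.CriticalCell (CommAnick.LetterMatching m a Set.univ) List.length 0,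
      c = e := fun c => Subtype.ext (List.length_eq_zero_iff.1 c.2.2)
  refine ⟨hM, AlgMorse.finite_paths hM hwf, ?_, ?_, ?_, CommAnick.range_letterMorseD_le hq⟩
  · intro y
    obtain ⟨x, rfl⟩ := Ideal.Quotient.mk_surjective y
    refine ⟨Finsupp.single e x, ?_⟩
    rw [Finsupp.linearCombination_single]
    exact congrArg (Ideal.Quotient.mk _) (mul_one x)
  · intro z
    obtain ⟨x, rfl⟩ : ∃ x, z = Finsupp.single e x := by
      refine ⟨z e, Finsupp.ext fun c => ?_⟩
      rw [he c, Finsupp.single_eq_same]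
    have haug : Finsupp.linearCombination (CommAnick.QuotAlg a)
        (fun _ => (1 : CommAnick.QuotAlg a ⧸ CommAnick.maxIdeal a)) (Finsupp.single e x) =
          Ideal.Quotient.mk _ x := by
      rw [Finsupp.linearCombination_single]
      exact congrArg (Ideal.Quotient.mk _) (mul_one x)
    rw [haug, Ideal.Quotient.eq_zero_iff_mem]
    constructor
    · intro hx
      obtain ⟨y, hy, hyx⟩ := CommAnick.bar_exact_zero hq hx
      -- The multiple of [] by an element of the maximal ideal bounds in the bar resolution. The
      -- projection carries the bounding chain to the Morse complex and fixes the critical cell [].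
      refine ⟨AlgMorse.projF (CommAnick.barD m a) (CommAnick.LetterMatching m a Set.univ)
        List.length 1 y, ?_⟩
      rw [← AlgMorse.projF_D hM hwf hlen hDD hy, hyx]
      have := AlgMorse.projF_inclF (R := CommAnick.QuotAlg a) hM hwf hlen 0 (Finsupp.single e x)
      rwa [AlgMorse.inclF_single] at this
    · intro hx
      -- Minimality in degree 0 already gives the inclusion of the image in the kernel: the
      -- coefficient at the only critical cell of degree 0 lies in the maximal ideal.
      have hx := CommAnick.range_letterMorseD_le hq 0 hx
      have hle : CommAnick.maxIdeal a • (⊤ : Submodule (CommAnick.QuotAlg a)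
          (AlgMorse.MorseModule (CommAnick.QuotAlg a) (CommAnick.LetterMatching m a Set.univ)
            List.length 0)) ≤
            Submodule.comap (Finsupp.lapply e) (CommAnick.maxIdeal a) := by
        refine Submodule.smul_le.2 fun r hr y _ => ?_
        exact Ideal.mul_mem_right _ _ hr
      simpa using hle hx
  · exact fun i => AlgMorse.exact_morseD hM hwf hlen hDD i fun x hx h0 =>
      CommAnick.bar_exact hq hx h0
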